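/- Let $k$ be a field. A lattice is a finitely generated free abelian group $M$; put $M_{\mathbb R}=M\otimes\mathbb R$ and let $N_{\mathbb R}$ be its dual space. A lattice polytope $P\subseteq M_{\mathbb R}$ is the convex hull of a nonempty finite set of lattice points. Its (inner) normal fan $\Sigma_P$ consists of the cones $\sigma_G=\{u\in N_{\mathbb R}: u \text{ attains its minimum on } P \text{ at every point of } G\}$, for $G$ a nonempty face of $P$. The toric variety $X_P$ of $P$ is the $k$-scheme obtained by gluing the affine charts $\operatorname{Spec} k[\sigma^\vee\cap M]$, $\sigma\in\Sigma_P$, along the open subschemes given by the inclusions of cones; its dense torus $T_P$ is the chart of the smallest cone of $\Sigma_P$, so its character lattice is the group of all $m\in M$ parallel to the affine hull of $P$ (all of $M$ if $P$ is full-dimensional). A morphism $X_P\to X_Q$ over $k$ is toric if it restricts to a homomorphism of tori $T_P\to T_Q$. Two lattice polytopes of the same dimension are normally equivalent if there is an inclusion-preserving bijection between their faces such that the affine hulls of corresponding faces are translates of each other, and their normal fans coincide; they then have the same toric variety. **Theorem.** Let $\pi\colon M\to\Lambda$ be a surjective homomorphism of lattices, with real extension $\pi_{\mathbb R}\colon M_{\mathbb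 R}\to\Lambda_{\mathbb R}$. Let $R_1,\dots,R_n\subseteq M_{\mathbb R}$ ($n\ge 1$) be pairwise normally equivalent lattice polytopes such that each $\pi_{\mathbb R}(R_i)$ is a single lattice point of $\Lambda$, and let $R=\operatorname{Conv}(R_1,\dots,R_n)$ (a generalized $\pi$-twisted Cayley sum). Assume that the $R_i$ are full-dimensional in the fibers of $\pi_{\mathbb R}$, that is, $\dim R_i=\operatorname{rank}\ker\pi$. Let $F=\pi_{\mathbb R}(R)$ and let $Y=X_{R_i}$ be the toric variety of the normally equivalent polytopes $R_i$. Then there is a toric morphism $f\colon X_R\to Y$ with generic fiber $X_F$: $Y$ has a generic point $\eta$, and the scheme-theoretic fiber of $f$ at $\eta$ is isomorphic over $\kappa(\eta)$ to $X_F\times_k\operatorname{Spec}\kappa(\eta)$; moreover, the fiber of $f$ at every point $y$ of the dense torus of $Y$ is isomorphic over $\kappa(y)$ to $X_F\times_k\operatorname{Spec}\kappa(y)$. -/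

import Mathlib

open CategoryTheory CategoryTheory.Limits AlgebraicGeometry TensorProduct
universe u
namespace ToricCayley

section Cones
variable {V : Type*} [AddCommGroup V] [Module ℝ V]

theorem fg_top_pointedCone [Module.Finite ℝ V] : (⊤ : PointedCone ℝ V).FG := by
  have h1 : Module.Finite {r : ℝ // 0 ≤ r} ℝ := by
    refine ⟨⟨{1, -1}, ?_⟩⟩
    rw [eq_top_iff]
    intro x _
    rcases le_total 0 x with hx | hx
    · have : x = (⟨x, hx⟩ : {r : ℝ // 0 ≤ r}) • (1 : ℝ) := (mul_one x).symm
      rw [this]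
      exact Submodule.smul_mem _ _ (Submodule.subset_span (by simp))
    · have : x = (⟨-x, by linarith⟩ : {r : ℝ // 0 ≤ r}) • (-1 : ℝ) := by
        show x = (-x) * (-1)
        ring
      rw [this]
      exact Submodule.smul_mem _ _ (Submodule.subset_span (by simp))
  have := Module.Finite.trans (R := {r : ℝ // 0 ≤ r}) ℝ V
  exact Module.Finite.fg_top

theorem fg_inf_halfspace {C : PointedCone ℝ V} (hC : C.FG) (a : V →ₗ[ℝ] ℝ) :
    ∃ D : PointedCone ℝ V, D.FG ∧ ∀ x, x ∈ D ↔ x ∈ C ∧ 0 ≤ a x := by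
  classical
  obtain ⟨S, rfl⟩ := hC
  set A := S.filter (fun g => 0 ≤ a g) with hA
  set B := S.filter (fun g => a g < 0) with hB
  set T : Finset V := A ∪ (A ×ˢ B).image (fun p => a p.1 • p.2 - a p.2 • p.1) with hT
  set D := PointedCone.hull ℝ (T : Set V) with hD
  have hAD : PointedCone.hull ℝ (A : Set V) ≤ D :=
    Submodule.span_mono (by intro x hx; simp [hT, Finset.mem_coe.1 hx])
  have hAa : ∀ y ∈ PointedCone.hull ℝ (A : Set V), 0 ≤ a y := by
    intro y hy
    induction hy using Submodule.span_induction with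
    | mem x hx => exact (Finset.mem_filter.1 hx).2
    | zero => simp
    | add x y _ _ hx hy => rw [map_add]; linarith
    | smul r x _ hx =>
      rw [show r • x = (r : ℝ) • x from rfl, map_smul]; exact mul_nonneg r.2 hx
  have hBa : ∀ z ∈ PointedCone.hull ℝ (B : Set V), a z < 0 ∨ z = 0 := by
    intro y hy
    induction hy using Submodule.span_induction with
    | mem x hx => exact Or.inl (Finset.mem_filter.1 hx).2
    | zero => simp
    | add x y _ _ hx hy =>
      rcases hx with hx | rfl
      · rcases hy with hy | rfl
        · left; rw [map_add]; linarith
        · left; simpa using hx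
      · simpa using hy
    | smul r x _ hx =>
      rcases hx with hx | rfl
      · rcases eq_or_lt_of_le r.2 with h | h
        · right
          rw [show r • x = (r : ℝ) • x from rfl, ← h, zero_smul]
        · left
          rw [show r • x = (r : ℝ) • x from rfl, map_smul]; exact mul_neg_of_pos_of_neg h hx
      · simp
  have hAB : ∀ y ∈ PointedCone.hull ℝ (A : Set V), ∀ z ∈ PointedCone.hull ℝ (B : Set V),
      a y • z - a z • y ∈ D := by
    intro y hy
    induction hy using Submodule.span_induction with
    | mem x hx =>
      intro z hz
      induction hz using Submodule.span_induction with
      | mem w hw =>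
        refine Submodule.subset_span ?_
        simp only [hT, Finset.coe_union, Finset.coe_image, Set.mem_union]
        exact Or.inr ⟨(x, w), by simpa using ⟨hx, hw⟩, rfl⟩
      | zero => simp
      | add w w' _ _ hw hw' =>
        have := D.add_mem hw hw'
        convert this using 1
        rw [map_add]; module
      | smul r w _ hw =>
        have := PointedCone.smul_mem D r.2 hw
        convert this using 1
        rw [show r • w = (r : ℝ) • w from rfl, map_smul, smul_eq_mul]
        module
    | zero => simp
    | add w w' _ _ hw hw' =>
      intro z hz
      have := D.add_mem (hw z hz) (hw' z hz)
      convert this using 1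
      rw [map_add]; module
    | smul r w _ hw =>
      intro z hz
      have := PointedCone.smul_mem D r.2 (hw z hz)
      convert this using 1
      rw [show r • w = (r : ℝ) • w from rfl, map_smul, smul_eq_mul]
      module
  refine ⟨D, ⟨T, rfl⟩, fun x => ⟨fun hx => ?_, fun hx => ?_⟩⟩
  · have hAS : ∀ g ∈ A, g ∈ PointedCone.hull ℝ (S : Set V) := fun g hg =>
      Submodule.subset_span (Finset.mem_filter.1 hg).1
    have hBS : ∀ g ∈ B, g ∈ PointedCone.hull ℝ (S : Set V) := fun g hg =>
      Submodule.subset_span (Finset.mem_filter.1 hg).1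
    constructor
    · refine (Submodule.span_le.2 ?_ : D ≤ PointedCone.hull ℝ (S : Set V)) hx
      intro g hg
      rcases Finset.mem_union.1 hg with hg | hg
      · exact hAS g hg
      · obtain ⟨⟨p, q⟩, hpq, rfl⟩ := Finset.mem_image.1 hg
        obtain ⟨hp, hq⟩ := Finset.mem_product.1 hpq
        have h1 := (Finset.mem_filter.1 hp).2
        have h2 := (Finset.mem_filter.1 hq).2
        show a p • q - a q • p ∈ _
        rw [sub_eq_add_neg, ← neg_smul]
        exact Submodule.add_mem _ (PointedCone.smul_mem _ h1 (hBS _ hq))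
          (PointedCone.smul_mem _ (by simp at h2 ⊢; linarith) (hAS _ hp))
    · induction hx using Submodule.span_induction with
      | mem g hg =>
        rcases Finset.mem_union.1 hg with hg | hg
        · exact (Finset.mem_filter.1 hg).2
        · obtain ⟨⟨p, q⟩, hpq, rfl⟩ := Finset.mem_image.1 hg
          simp [mul_comm]
      | zero => simp
      | add x y _ _ hx hy => rw [map_add]; linarith
      | smul r x _ hx =>
        rw [show r • x = (r : ℝ) • x from rfl, map_smul]; exact mul_nonneg r.2 hx
  · obtain ⟨hxS, hxa⟩ := hx
    have hSU : (S : Set V) = (A : Set V) ∪ (B : Set V) := by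
      ext g
      simp only [hA, hB, Finset.coe_filter, Set.mem_union, Set.mem_ofPred_eq, Finset.mem_coe]
      rcases le_or_gt 0 (a g) with h | h
      · simp [h, not_lt.2 h]
      · simp [h, not_le.2 h]
    rw [hSU, Submodule.span_union, Submodule.mem_sup] at hxS
    obtain ⟨y, hy, z, hz, rfl⟩ := hxS
    rw [map_add] at hxa
    rcases hBa z hz with hz0 | rfl
    · have hy0 : 0 < a y := by linarith
      have : y + z = (a y)⁻¹ • (a y • z - a z • y) + (1 + a z / a y) • y := by
        rw [smul_sub, smul_smul, inv_mul_cancel₀ hy0.ne', one_smul, smul_smul, add_smul, one_smul,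
          div_eq_inv_mul]
        abel
      rw [this]
      refine D.add_mem (PointedCone.smul_mem _ (by positivity) (hAB y hy z hz))
        (PointedCone.smul_mem _ ?_ (hAD hy))
      have : -1 ≤ a z / a y := by rw [le_div_iff₀ hy0]; linarith
      linarith
    · simpa using hAD hy

/-- A finite intersection of closed linear halfspaces is a finitely generated cone. -/
theorem fg_of_finite_halfspaces [Module.Finite ℝ V] {ι : Type*} (s : Finset ι)
    (a : ι → (V →ₗ[ℝ] ℝ)) :
    ∃ D : PointedCone ℝ V, D.FG ∧ ∀ x, x ∈ D ↔ ∀ i ∈ s, 0 ≤ a i x := by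
  classical
  induction s using Finset.induction_on with
  | empty => exact ⟨⊤, fg_top_pointedCone, by simp⟩
  | insert i s _ ih =>
    obtain ⟨D, hD, h⟩ := ih
    obtain ⟨D', hD', h'⟩ := fg_inf_halfspace hD (a i)
    refine ⟨D', hD', fun x => ?_⟩
    rw [h', h]
    simp [and_comm]

/-- If `b` is nonnegative on a polyhedral cone `C`, and `m` is nonnegative on `C ∩ b^⊥`, then
`m + n b` is nonnegative on `C` for some natural number `n`. -/
theorem exists_nat_add_nonneg {C : PointedCone ℝ V} (hC : C.FG) (b m : V →ₗ[ℝ] ℝ)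
    (hb : ∀ x ∈ C, 0 ≤ b x) (hm : ∀ x ∈ C, b x = 0 → 0 ≤ m x) :
    ∃ n : ℕ, ∀ x ∈ C, 0 ≤ m x + n * b x := by
  classical
  obtain ⟨S, rfl⟩ := hC
  have key : ∀ g ∈ S, ∃ n : ℕ, 0 ≤ m g + n * b g := by
    intro g hg
    have hg' : g ∈ PointedCone.hull ℝ (S : Set V) := Submodule.subset_span hg
    rcases eq_or_lt_of_le (hb g hg') with h | h
    · exact ⟨0, by simpa using hm g hg' h.symm⟩
    · obtain ⟨n, hn⟩ := exists_nat_ge (-(m g) / b g)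
      rw [div_le_iff₀ h] at hn
      exact ⟨n, by linarith⟩
  choose! n hn using key
  refine ⟨S.sup n, fun x hx => ?_⟩
  induction hx using Submodule.span_induction with
  | mem g hg =>
    have h1 := hn g hg
    have h2 : (n g : ℝ) ≤ (S.sup n : ℕ) := by exact_mod_cast Finset.le_sup (f := n) hg
    have h3 := hb g (Submodule.subset_span hg)
    nlinarith
  | zero => simp
  | add x y _ _ hx hy => rw [map_add, map_add]; linarith
  | smul r x _ hx =>
    rw [show r • x = (r : ℝ) • x from rfl, map_smul, map_smul]
    have := mul_nonneg r.2 hx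
    simp only [smul_eq_mul]
    nlinarith

end Cones

section Polytopes
variable (M : Type u) [AddCommGroup M]

/-- The real vector space `M_ℝ = ℝ ⊗ M` of a lattice `M`. -/
abbrev RealExt : Type u := ℝ ⊗[ℤ] M

/-- The space `N_ℝ` dual to `M_ℝ`, where `N` is the lattice dual to `M`. -/
abbrev DualExt : Type u := Module.Dual ℝ (RealExt M)

variable {M}

/-- A lattice point `m ∈ M`, viewed in `M_ℝ`. -/
def latticePt (m : M) : RealExt M := (1 : ℝ) ⊗ₜ[ℤ] m

@[simp] theorem latticePt_zero : latticePt (0 : M) = 0 := TensorProduct.tmul_zero _ _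

@[simp] theorem latticePt_add (m n : M) : latticePt (m + n) = latticePt m + latticePt n :=
  TensorProduct.tmul_add _ _ _

@[simp] theorem latticePt_sub (m n : M) : latticePt (m - n) = latticePt m - latticePt n :=
  TensorProduct.tmul_sub _ _ _

theorem latticePt_nsmul (n : ℕ) (m : M) : latticePt (n • m) = (n : ℝ) • latticePt m := by
  induction n with
  | zero => simp
  | succ n ih => rw [succ_nsmul, latticePt_add, ih, Nat.cast_succ, add_smul, one_smul]

theorem latticePt_sum {ι : Type*} (s : Finset ι) (f : ι → M) :
    latticePt (∑ i ∈ s, f i) = ∑ i ∈ s, latticePt (f i) :=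
  TensorProduct.tmul_sum _ _ _

variable (M) in
/-- A (nonempty) lattice polytope in `M_ℝ`: the convex hull of a nonempty finite set of
lattice points. -/
structure LatticePolytope where
  carrier : Set (RealExt M)
  exists_vertices : ∃ V : Finset M, V.Nonempty ∧ carrier = convexHull ℝ (latticePt '' (V : Set M))

namespace LatticePolytope

/-- The dimension of a polytope, that is, of its affine hull. -/
noncomputable def dim (P : LatticePolytope M) : ℕ :=
  Module.finrank ℝ (vectorSpan ℝ P.carrier)

/-- The face of `P` on which the linear functional `u` attains its minimum over `P`. -/
def face (P : LatticePolytope M) (u : DualExt M) : Set (RealExt M) :=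
  {p | p ∈ P.carrier ∧ ∀ q ∈ P.carrier, u p ≤ u q}

/-- The nonempty faces of `P` (`P` itself is the face of the functional `0`). -/
def IsFace (P : LatticePolytope M) (G : Set (RealExt M)) : Prop :=
  G.Nonempty ∧ ∃ u : DualExt M, G = P.face u

/-- The (inner) normal cone of `P` at a subset `G`: all functionals that attain their minimum
over `P` at every point of `G`. -/
def normalCone (P : LatticePolytope M) (G : Set (RealExt M)) : PointedCone ℝ (DualExt M) where
  carrier := {u | ∀ g ∈ G, ∀ p ∈ P.carrier, u g ≤ u p}
  zero_mem' := by intro g _ p _; simp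
  add_mem' := by
    intro u v hu hv g hg p hp
    exact add_le_add (hu g hg p hp) (hv g hg p hp)
  smul_mem' := by
    intro r u hu g hg p hp
    exact mul_le_mul_of_nonneg_left (hu g hg p hp) r.2

/-- The (inner) normal fan of `P` in `N_ℝ`: the set of the normal cones at the faces of `P`.
If `P` is not full-dimensional, all its cones contain the linear space `(P - P)^⊥`. -/
def normalFan (P : LatticePolytope M) : Set (PointedCone ℝ (DualExt M)) :=
  {σ | ∃ G, P.IsFace G ∧ σ = P.normalCone G}

theorem mem_normalCone {P : LatticePolytope M} {G : Set (RealExt M)} {u : DualExt M} :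
    u ∈ P.normalCone G ↔ ∀ g ∈ G, ∀ p ∈ P.carrier, u g ≤ u p := Iff.rfl

/-- `V` is a finite set of lattice points whose convex hull is `P`. -/
def IsGenerating (P : LatticePolytope M) (V : Finset M) : Prop :=
  V.Nonempty ∧ P.carrier = convexHull ℝ (latticePt '' (V : Set M))

section
variable {P : LatticePolytope M} {V : Finset M}

theorem IsGenerating.mem (hV : P.IsGenerating V) {v : M} (hv : v ∈ V) :
    latticePt v ∈ P.carrier := by
  rw [hV.2]
  exact subset_convexHull _ _ ⟨v, hv, rfl⟩

theorem IsGenerating.le_of_forall (hV : P.IsGenerating V) (u : DualExt M) (c : ℝ)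
    (h : ∀ v ∈ V, c ≤ u (latticePt v)) : ∀ p ∈ P.carrier, c ≤ u p := by
  intro p hp
  rw [hV.2] at hp
  have : convexHull ℝ (latticePt '' (V : Set M)) ⊆ {x | c ≤ u x} := by
    refine convexHull_min ?_ (convex_halfSpace_ge u.isLinear c)
    rintro _ ⟨v, hv, rfl⟩
    exact h v hv
  exact this hp

theorem IsGenerating.exists_mem_face (hV : P.IsGenerating V) (u : DualExt M) :
    ∃ v ∈ V, latticePt v ∈ P.face u := by
  obtain ⟨v, hv, h⟩ := V.exists_min_image (fun v => u (latticePt v)) hV.1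
  exact ⟨v, hv, hV.mem hv, hV.le_of_forall u _ h⟩

theorem IsGenerating.isFace_face (hV : P.IsGenerating V) (u : DualExt M) : P.IsFace (P.face u) := by
  obtain ⟨v, _, h⟩ := hV.exists_mem_face u
  exact ⟨⟨_, h⟩, u, rfl⟩

/-- A functional belongs to the normal cone of a face as soon as it attains its minimum at all the
lattice points of the generating set that lie on the face. -/
theorem IsGenerating.mem_normalCone_face (hV : P.IsGenerating V) (w u : DualExt M)
    (h : ∀ g ∈ V, latticePt g ∈ P.face w → ∀ v ∈ V, u (latticePt g) ≤ u (latticePt v)) :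
    u ∈ P.normalCone (P.face w) := by
  classical
  intro x hx p hp
  obtain ⟨g, hg, hgw⟩ := hV.exists_mem_face w
  have hgp := hV.le_of_forall u _ (h g hg hgw) p hp
  refine le_trans ?_ hgp
  have hxV := hx.1
  rw [hV.2, ← Finset.coe_image, Finset.mem_convexHull'] at hxV
  obtain ⟨c, hc0, hc1, hcx⟩ := hxV
  have hwx : w x = w (latticePt g) := le_antisymm (hx.2 _ hgw.1) (hgw.2 _ hx.1)
  have hsum : ∑ y ∈ V.image latticePt, c y * (w y - w (latticePt g)) = 0 := by
    simp only [mul_sub, Finset.sum_sub_distrib, ← Finset.sum_mul, hc1]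
    rw [← hcx, map_sum] at hwx
    simp only [map_smul, smul_eq_mul] at hwx
    rw [hwx]; ring
  have hmem : ∀ y ∈ V.image (latticePt : M → RealExt M), y ∈ P.carrier := by
    intro y hy
    obtain ⟨v, hv, rfl⟩ := Finset.mem_image.1 hy
    exact hV.mem hv
  rw [Finset.sum_eq_zero_iff_of_nonneg (fun y hy => mul_nonneg (hc0 y hy)
    (sub_nonneg.2 (hgw.2 y (hmem y hy))))] at hsum
  rw [← hcx, map_sum]
  calc ∑ y ∈ V.image latticePt, u (c y • y)
      ≤ ∑ y ∈ V.image latticePt, c y * u (latticePt g) := by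
        refine Finset.sum_le_sum fun y hy => ?_
        rw [map_smul, smul_eq_mul]
        rcases mul_eq_zero.1 (hsum y hy) with h0 | h0
        · rw [h0]; simp
        · refine mul_le_mul_of_nonneg_left ?_ (hc0 y hy)
          obtain ⟨v, hv, rfl⟩ := Finset.mem_image.1 hy
          refine h v hv ⟨hV.mem hv, fun q hq => ?_⟩ g hg
          rw [sub_eq_zero.1 h0]
          exact hgw.2 q hq
    _ = u (latticePt g) := by rw [← Finset.sum_mul, hc1, one_mul]

/-- The normal cone at a nonempty subset of the polytope is the normal cone at some face. -/
theorem exists_face_normalCone_eq (P : LatticePolytope M) (A : Set (RealExt M))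
    (hA : A ⊆ P.carrier) (hne : A.Nonempty) : P.normalCone A ∈ P.normalFan := by
  classical
  obtain ⟨V, hV⟩ := P.exists_vertices
  have hV : P.IsGenerating V := hV
  have key : ∀ v : M, ∃ u ∈ P.normalCone A, (∃ u' ∈ P.normalCone A, latticePt v ∉ P.face u') →
      latticePt v ∉ P.face u := by
    intro v
    by_cases h : ∃ u' ∈ P.normalCone A, latticePt v ∉ P.face u'
    · obtain ⟨u, hu, hv⟩ := h
      exact ⟨u, hu, fun _ => hv⟩
    · exact ⟨0, Submodule.zero_mem _, fun h' => absurd h' h⟩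
  choose u hu hu' using key
  set w : DualExt M := ∑ v ∈ V, u v with hw
  have hwA : w ∈ P.normalCone A := Submodule.sum_mem _ fun v _ => hu v
  refine ⟨P.face w, hV.isFace_face w, le_antisymm ?_ ?_⟩
  · intro z hz
    refine hV.mem_normalCone_face w z fun g hg hgw v hv => ?_
    by_contra hcon
    have hg' : latticePt g ∉ P.face (u g) :=
      hu' g ⟨z, hz, fun hmem => hcon (hmem.2 _ (hV.mem hv))⟩
    apply hg'
    refine ⟨hV.mem hg, fun q hq => ?_⟩
    obtain ⟨a, ha⟩ := hne
    have hle : ∀ v ∈ V, u v a ≤ u v (latticePt g) := fun v _ => hu v a ha _ (hV.mem hg)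
    have hsum : ∑ v ∈ V, (u v (latticePt g) - u v a) = 0 := by
      have h1 := hgw.2 a (hA ha)
      have h2 := hwA a ha _ (hV.mem hg)
      simp only [hw, LinearMap.sum_apply] at h1 h2
      rw [Finset.sum_sub_distrib]
      linarith
    rw [Finset.sum_eq_zero_iff_of_nonneg (fun v hv => sub_nonneg.2 (hle v hv))] at hsum
    rw [sub_eq_zero.1 (hsum g hg)]
    exact hu g a ha q hq
  · intro z hz a ha p hp
    exact hz a ⟨hA ha, fun q hq => hwA a ha q hq⟩ p hp
end

/-- The intersection of two cones of the normal fan is in the normal fan. -/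
theorem inf_mem_normalFan (P : LatticePolytope M) {σ τ : PointedCone ℝ (DualExt M)}
    (hσ : σ ∈ P.normalFan) (hτ : τ ∈ P.normalFan) : σ ⊓ τ ∈ P.normalFan := by
  obtain ⟨G, ⟨hG, u, rfl⟩, rfl⟩ := hσ
  obtain ⟨H, ⟨hH, v, rfl⟩, rfl⟩ := hτ
  have h : P.normalCone (P.face u) ⊓ P.normalCone (P.face v) =
      P.normalCone (P.face u ∪ P.face v) := by
    ext z
    simp only [Submodule.mem_inf, mem_normalCone, Set.mem_union]
    exact ⟨fun h g hg => hg.elim (h.1 g) (h.2 g),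
      fun h => ⟨fun g hg => h g (Or.inl hg), fun g hg => h g (Or.inr hg)⟩⟩
  rw [h]
  exact P.exists_face_normalCone_eq _
    (Set.union_subset (fun x hx => hx.1) fun x hx => hx.1) (hG.mono Set.subset_union_left)

/-- If `τ ⊆ σ` are cones of the normal fan, then `τ` is the face `σ ∩ m^⊥` of `σ` for a lattice
point `m` in the dual cone of `σ`. -/
theorem exists_face_functional (P : LatticePolytope M) {σ τ : PointedCone ℝ (DualExt M)}
    (hσ : σ ∈ P.normalFan) (hτ : τ ∈ P.normalFan) (h : τ ≤ σ) :
    ∃ m : M, (∀ u ∈ σ, 0 ≤ u (latticePt m)) ∧ ∀ u ∈ σ, (u ∈ τ ↔ u (latticePt m) = 0) := by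
  classical
  obtain ⟨V, hV⟩ := P.exists_vertices
  have hV : P.IsGenerating V := hV
  obtain ⟨G, ⟨hG, a, rfl⟩, rfl⟩ := hσ
  obtain ⟨H, ⟨hH, b, rfl⟩, rfl⟩ := hτ
  obtain ⟨g, hg, hga⟩ := hV.exists_mem_face a
  set W := V.filter (fun v => latticePt v ∈ P.face b) with hW
  have heval : ∀ u : DualExt M, u (latticePt (∑ v ∈ W, (v - g))) =
      ∑ v ∈ W, (u (latticePt v) - u (latticePt g)) := by
    intro u
    rw [latticePt_sum, map_sum]
    exact Finset.sum_congr rfl fun v _ => by rw [latticePt_sub, map_sub]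
  have hnn : ∀ u ∈ P.normalCone (P.face a), ∀ v ∈ W,
      0 ≤ u (latticePt v) - u (latticePt g) := fun u hu v hv =>
    sub_nonneg.2 (hu _ hga _ (hV.mem (Finset.mem_filter.1 hv).1))
  refine ⟨∑ v ∈ W, (v - g), fun u hu => ?_, fun u hu => ?_⟩
  · rw [heval]
    exact Finset.sum_nonneg (hnn u hu)
  · rw [heval, Finset.sum_eq_zero_iff_of_nonneg (hnn u hu)]
    constructor
    · intro hub v hv
      have h1 := hub _ (Finset.mem_filter.1 hv).2 _ (hV.mem hg)
      have h2 := hnn u hu v hv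
      linarith
    · intro h0
      refine hV.mem_normalCone_face b u fun v hv hvb v' hv' => ?_
      rw [sub_eq_zero.1 (h0 v (Finset.mem_filter.2 ⟨hv, hvb⟩))]
      exact hu _ hga _ (hV.mem hv')

theorem fg_of_mem_normalFan [Module.Free ℤ M] [Module.Finite ℤ M] (P : LatticePolytope M)
    {σ : PointedCone ℝ (DualExt M)} (hσ : σ ∈ P.normalFan) : σ.FG := by
  classical
  obtain ⟨V, hV⟩ := P.exists_vertices
  have hV : P.IsGenerating V := hV
  obtain ⟨G, ⟨hG, a, rfl⟩, rfl⟩ := hσ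
  obtain ⟨D, hD, hmem⟩ := fg_of_finite_halfspaces
    ((V.filter (fun v => latticePt v ∈ P.face a)) ×ˢ V)
    (fun p => Module.Dual.eval ℝ (RealExt M) (latticePt p.2 - latticePt p.1))
  suffices h : P.normalCone (P.face a) = D from h ▸ hD
  refine SetLike.ext fun u => ?_
  rw [hmem]
  constructor
  · rintro hu ⟨g, v⟩ hgv
    obtain ⟨h1, h2⟩ := Finset.mem_product.1 hgv
    have := hu _ (Finset.mem_filter.1 h1).2 _ (hV.mem h2)
    simpa using this
  · intro hu
    refine hV.mem_normalCone_face a u fun g hg hga v hv => ?_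
    have := hu (g, v) (Finset.mem_product.2 ⟨Finset.mem_filter.2 ⟨hg, hga⟩, hv⟩)
    simpa using this

/-- The normal cone at the whole polytope; it is the smallest cone of the normal fan, and it is
zero exactly when `P` is full-dimensional. -/
def minCone (P : LatticePolytope M) : PointedCone ℝ (DualExt M) := P.normalCone P.carrier

theorem minCone_mem_normalFan (P : LatticePolytope M) : P.minCone ∈ P.normalFan := by
  obtain ⟨V, hV⟩ := P.exists_vertices
  have hV : P.IsGenerating V := hV
  obtain ⟨v, hv⟩ := hV.1
  exact P.exists_face_normalCone_eq _ subset_rfl ⟨_, hV.mem hv⟩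

end LatticePolytope
end Polytopes

section Charts
variable (k : Type u) [Field k] {M : Type u} [AddCommGroup M]

/-- The semigroup `σ^∨ ∩ M` of a cone `σ` in `N_ℝ`. -/
def dualMonoid (σ : PointedCone ℝ (DualExt M)) : AddSubmonoid M where
  carrier := {m | ∀ u ∈ σ, 0 ≤ u (latticePt m)}
  zero_mem' := by intro u _; simp
  add_mem' := by
    intro m n hm hn u hu
    rw [latticePt_add, map_add]
    exact add_nonneg (hm u hu) (hn u hu)

theorem mem_dualMonoid {σ : PointedCone ℝ (DualExt M)} {m : M} :
    m ∈ dualMonoid σ ↔ ∀ u ∈ σ, 0 ≤ u (latticePt m) := Iff.rfl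

theorem dualMonoid_anti {σ τ : PointedCone ℝ (DualExt M)} (h : τ ≤ σ) :
    dualMonoid σ ≤ dualMonoid τ := fun _ hm u hu => hm u (h hu)

/-- The affine scheme `Spec k[S]` of a commutative monoid `S`. -/
noncomputable abbrev monoidSpec (S : Type u) [AddCommMonoid S] : Scheme.{u} :=
  Spec (.of (AddMonoidAlgebra k S))

/-- The morphism `Spec k[T] ⟶ Spec k[S]` induced by a homomorphism `S →+ T`. -/
noncomputable def monoidSpecMap {S T : Type u} [AddCommMonoid S] [AddCommMonoid T] (φ : S →+ T) :
    monoidSpec k T ⟶ monoidSpec k S :=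
  Spec.map (CommRingCat.ofHom (AddMonoidAlgebra.mapDomainRingHom k φ))

/-- The structure morphism `Spec k[S] ⟶ Spec k`. -/
noncomputable def monoidSpecStr (S : Type u) [AddCommMonoid S] :
    monoidSpec k S ⟶ Spec (.of k) :=
  Spec.map (CommRingCat.ofHom (algebraMap k (AddMonoidAlgebra k S)))

theorem monoidSpecMap_id (S : Type u) [AddCommMonoid S] :
    monoidSpecMap k (AddMonoidHom.id S) = 𝟙 _ := by
  simp only [monoidSpecMap, AddMonoidAlgebra.mapDomainRingHom_id]
  exact Spec.map_id _

theorem monoidSpecMap_comp {S T U : Type u} [AddCommMonoid S] [AddCommMonoid T] [AddCommMonoid U]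
    (φ : S →+ T) (ψ : T →+ U) :
    monoidSpecMap k (ψ.comp φ) = monoidSpecMap k ψ ≫ monoidSpecMap k φ := by
  simp only [monoidSpecMap, AddMonoidAlgebra.mapDomainRingHom_comp]
  exact Spec.map_comp (CommRingCat.ofHom (AddMonoidAlgebra.mapDomainRingHom k φ))
    (CommRingCat.ofHom (AddMonoidAlgebra.mapDomainRingHom k ψ))

theorem monoidSpecMap_str {S T : Type u} [AddCommMonoid S] [AddCommMonoid T] (φ : S →+ T) :
    monoidSpecMap k φ ≫ monoidSpecStr k S = monoidSpecStr k T := by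
  simp only [monoidSpecMap, monoidSpecStr]
  rw [← Spec.map_comp, ← CommRingCat.ofHom_comp]
  congr 2
  ext x
  simp

/-- If `T = S + ℕ(-s)` as submonoids of a group, then `k[T]` is the localization of `k[S]`
at the monomial of `s`. -/
theorem isLocalization_away {S T : AddSubmonoid M} (h : S ≤ T) (s : S) (hs : -(s : M) ∈ T)
    (hT : ∀ t ∈ T, ∃ n : ℕ, t + n • (s : M) ∈ S) :
    letI := (AddMonoidAlgebra.mapDomainRingHom k (AddSubmonoid.inclusion h)).toAlgebra
    IsLocalization.Away (AddMonoidAlgebra.single s (1 : k)) (AddMonoidAlgebra k T) := by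
  let _ := (AddMonoidAlgebra.mapDomainRingHom k (AddSubmonoid.inclusion h)).toAlgebra
  have hmap : ∀ x : AddMonoidAlgebra k S, algebraMap (AddMonoidAlgebra k S) (AddMonoidAlgebra k T) x
      = AddMonoidAlgebra.mapDomainRingHom k (AddSubmonoid.inclusion h) x := fun _ => rfl
  have hsingle : ∀ (x : S) (c : k),
      algebraMap (AddMonoidAlgebra k S) (AddMonoidAlgebra k T) (AddMonoidAlgebra.single x c)
      = AddMonoidAlgebra.single (AddSubmonoid.inclusion h x) c := by
    intro x c
    rw [hmap]; simp
  refine IsLocalization.Away.mk _ ?_ ?_ ?_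
  · rw [hsingle]
    refine IsUnit.of_mul_eq_one (AddMonoidAlgebra.single (⟨-(s : M), hs⟩ : T) (1 : k)) ?_
    rw [AddMonoidAlgebra.single_mul_single, AddMonoidAlgebra.one_def]
    congr 1
    · ext; simp
    · simp
  · intro z
    induction z using AddMonoidAlgebra.induction_linear with
    | zero => exact ⟨0, 0, by simp⟩
    | add f g hf hg =>
      obtain ⟨n, a, ha⟩ := hf
      obtain ⟨m, b, hb⟩ := hg
      refine ⟨n + m, a * AddMonoidAlgebra.single s (1 : k) ^ m +
        b * AddMonoidAlgebra.single s (1 : k) ^ n, ?_⟩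
      rw [map_add, map_mul, map_mul, map_pow, map_pow, ← ha, ← hb]
      ring
    | single t c =>
      obtain ⟨n, hn⟩ := hT t t.2
      refine ⟨n, AddMonoidAlgebra.single ⟨_, hn⟩ c, ?_⟩
      rw [hsingle, hsingle, AddMonoidAlgebra.single_pow, AddMonoidAlgebra.single_mul_single]
      rw [one_pow, mul_one]
      congr 1
  · intro a b hab
    refine ⟨0, ?_⟩
    have : a = b := AddMonoidAlgebra.mapDomain_injective (AddSubmonoid.inclusion_injective h) hab
    rw [this]

theorem isOpenImmersion_and_range {S T : AddSubmonoid M} (h : S ≤ T) (s : S) (hs : -(s : M) ∈ T)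
    (hT : ∀ t ∈ T, ∃ n : ℕ, t + n • (s : M) ∈ S) :
    IsOpenImmersion (monoidSpecMap k (AddSubmonoid.inclusion h)) ∧
    ∀ x, x ∈ Set.range (monoidSpecMap k (AddSubmonoid.inclusion h)) ↔
      AddMonoidAlgebra.single s (1 : k) ∉ x.asIdeal := by
  let _ := (AddMonoidAlgebra.mapDomainRingHom k (AddSubmonoid.inclusion h)).toAlgebra
  have := isLocalization_away k h s hs hT
  refine ⟨IsOpenImmersion.of_isLocalization (AddMonoidAlgebra.single s (1 : k)), fun x => ?_⟩
  exact Set.ext_iff.1 (PrimeSpectrum.localization_away_comap_range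
    (AddMonoidAlgebra k T) (AddMonoidAlgebra.single s (1 : k))) x

end Charts

section ToricVariety
variable (k : Type u) [Field k] {M : Type u} [AddCommGroup M] (P : LatticePolytope M)

/-- The diagram of the affine toric charts `U_σ = Spec k[σ^∨ ∩ M]`, for `σ` in the normal fan of
`P`, with the morphisms `U_τ ⟶ U_σ` for `τ ⊆ σ`. -/
noncomputable def chartDiagram : P.normalFan ⥤ Scheme.{u} where
  obj σ := monoidSpec k (dualMonoid σ.1)
  map f := monoidSpecMap k (AddSubmonoid.inclusion (dualMonoid_anti (leOfHom f)))
  map_id σ := monoidSpecMap_id k _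
  map_comp f g := by
    rw [← monoidSpecMap_comp]
    rfl

variable {P} in
theorem exists_chart_functional {σ τ : P.normalFan} (f : τ ⟶ σ) :
    ∃ s : dualMonoid σ.1, ∀ u ∈ σ.1, (u ∈ τ.1 ↔ u (latticePt (s : M)) = 0) := by
  obtain ⟨m, hm0, hm⟩ := P.exists_face_functional σ.2 τ.2 (leOfHom f)
  exact ⟨⟨m, hm0⟩, hm⟩

variable [Module.Free ℤ M] [Module.Finite ℤ M]

variable {P} in
theorem chart_face {σ τ : P.normalFan} (f : τ ⟶ σ) (s : dualMonoid σ.1)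
    (hs : ∀ u ∈ σ.1, (u ∈ τ.1 ↔ u (latticePt (s : M)) = 0)) :
    IsOpenImmersion ((chartDiagram k P).map f) ∧
      ∀ x : (chartDiagram k P).obj σ, x ∈ Set.range ((chartDiagram k P).map f) ↔
        AddMonoidAlgebra.single s (1 : k) ∉ PrimeSpectrum.asIdeal x := by
  refine isOpenImmersion_and_range k (dualMonoid_anti (leOfHom f)) s ?_ ?_
  · intro u hu
    have := (hs u (leOfHom f hu)).1 hu
    have h0 : latticePt (-(s : M)) = -latticePt (s : M) := by
      rw [← zero_sub, latticePt_sub, latticePt_zero, zero_sub]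
    simp [h0, this]
  · intro t ht
    obtain ⟨n, hn⟩ := exists_nat_add_nonneg (P.fg_of_mem_normalFan σ.2)
      (Module.Dual.eval ℝ (RealExt M) (latticePt (s : M)))
      (Module.Dual.eval ℝ (RealExt M) (latticePt t))
      (fun u hu => s.2 u hu) (fun u hu h0 => ht u ((hs u hu).2 h0))
    refine ⟨n, fun u hu => ?_⟩
    have := hn u hu
    simpa [latticePt_nsmul] using this

instance {σ τ : P.normalFan} (f : τ ⟶ σ) : IsOpenImmersion ((chartDiagram k P).map f) := by
  obtain ⟨s, hs⟩ := exists_chart_functional f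
  exact (chart_face k f s hs).1

instance : (chartDiagram k P ⋙ Scheme.forget).IsLocallyDirected where
  cond := by
    intro i j l fi fj xi xj hx
    replace hx : (chartDiagram k P).map fi xi = (chartDiagram k P).map fj xj := hx
    let c : P.normalFan := ⟨i.1 ⊓ j.1, P.inf_mem_normalFan i.2 j.2⟩
    let gi : c ⟶ i := homOfLE (show i.1 ⊓ j.1 ≤ i.1 from inf_le_left)
    let gj : c ⟶ j := homOfLE (show i.1 ⊓ j.1 ≤ j.1 from inf_le_right)
    obtain ⟨si, hsi⟩ := exists_chart_functional fi
    obtain ⟨sj, hsj⟩ := exists_chart_functional fj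
    have hi := ((chart_face k fi si hsi).2 ((chartDiagram k P).map fi xi)).1 ⟨xi, rfl⟩
    have hj := ((chart_face k fj sj hsj).2 ((chartDiagram k P).map fi xi)).1 ⟨xj, hx.symm⟩
    have hc : ∀ u ∈ l.1, (u ∈ c.1 ↔ u (latticePt ((si + sj : dualMonoid l.1) : M)) = 0) := by
      intro u hu
      have h1 := si.2 u hu
      have h2 := sj.2 u hu
      have h3 : u ∈ c.1 ↔ u ∈ i.1 ∧ u ∈ j.1 := Submodule.mem_inf
      rw [h3, hsi u hu, hsj u hu, AddSubmonoid.coe_add, latticePt_add, map_add]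
      constructor
      · rintro ⟨h, h'⟩
        rw [h, h', add_zero]
      · intro h
        constructor <;> linarith
    obtain ⟨x, hxc⟩ := ((chart_face k (gi ≫ fi) (si + sj) hc).2 ((chartDiagram k P).map fi xi)).2 (by
      rw [show AddMonoidAlgebra.single (si + sj) (1 : k) =
        AddMonoidAlgebra.single si 1 * AddMonoidAlgebra.single sj 1 by
          rw [AddMonoidAlgebra.single_mul_single, one_mul]]
      intro hmem
      exact ((PrimeSpectrum.isPrime _).mem_or_mem hmem).elim hi hj)
    have hcomp : gi ≫ fi = gj ≫ fj := rfl
    refine ⟨c, gi, gj, x, ?_, ?_⟩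
    · apply ((chartDiagram k P).map fi).isOpenEmbedding.injective
      rw [Functor.map_comp, Scheme.Hom.comp_apply] at hxc
      exact hxc
    · apply ((chartDiagram k P).map fj).isOpenEmbedding.injective
      rw [hcomp, Functor.map_comp, Scheme.Hom.comp_apply] at hxc
      exact hxc.trans hx

/-- The toric variety `X_P` over `k` of the normal fan of the lattice polytope `P`: the gluing of
the affine charts `U_σ = Spec k[σ^∨ ∩ M]` along the open subschemes `U_τ ⊆ U_σ` for `τ ⊆ σ`. -/
noncomputable def toricVariety : Scheme.{u} := colimit (chartDiagram k P)

/-- The structure morphism `X_P ⟶ Spec k`. -/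
noncomputable def toricVarietyStr : toricVariety k P ⟶ Spec (.of k) :=
  colimit.desc (chartDiagram k P)
    { pt := Spec (.of k)
      ι := { app := fun σ => monoidSpecStr k (dualMonoid σ.1)
             naturality := fun σ τ f => by
               exact (monoidSpecMap_str k (AddSubmonoid.inclusion
                 (dualMonoid_anti (leOfHom f)))).trans (Category.comp_id _).symm } }

/-- The inclusion in `X_P` of its dense torus, the chart of the smallest cone of the normal fan;
its character lattice `dualMonoid P.minCone` consists of the `m ∈ M` parallel to the affine hull
of `P` (so it is all of `M` if `P` is full-dimensional). -/
noncomputable def torusι : monoidSpec k (dualMonoid P.minCone) ⟶ toricVariety k P :=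
  colimit.ι (chartDiagram k P) ⟨P.minCone, P.minCone_mem_normalFan⟩

end ToricVariety

section Cayley
variable {M Λ : Type u} [AddCommGroup M] [AddCommGroup Λ]

namespace LatticePolytope

/-- The image `π_ℝ(P)` of a lattice polytope under a homomorphism of lattices. -/
noncomputable def map (π : M →ₗ[ℤ] Λ) (P : LatticePolytope M) : LatticePolytope Λ where
  carrier := π.baseChange ℝ '' P.carrier
  exists_vertices := by
    classical
    obtain ⟨V, hV, h⟩ := P.exists_vertices
    refine ⟨V.image π, hV.image _, ?_⟩
    rw [h, LinearMap.image_convexHull, Finset.coe_image, Set.image_image, Set.image_image]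
    rfl

/-- The convex hull `Conv(R_1, …, R_k)` of a nonempty finite family of lattice polytopes. -/
def conv {ι : Type*} [Finite ι] [Nonempty ι] (R : ι → LatticePolytope M) : LatticePolytope M where
  carrier := convexHull ℝ (⋃ i, (R i).carrier)
  exists_vertices := by
    classical
    have := Fintype.ofFinite ι
    choose V hV h using fun i => (R i).exists_vertices
    refine ⟨Finset.univ.biUnion V, ?_, ?_⟩
    · obtain ⟨i⟩ := ‹Nonempty ι›
      obtain ⟨v, hv⟩ := hV i
      exact ⟨v, Finset.mem_biUnion.2 ⟨i, Finset.mem_univ _, hv⟩⟩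
    · simp only [h, Finset.coe_biUnion, Finset.coe_univ, Set.mem_univ, Set.iUnion_true,
        Set.image_iUnion]
      refine subset_antisymm (convexHull_min (Set.iUnion_subset fun i => ?_) (convex_convexHull _ _))
        (convexHull_mono (Set.iUnion_mono fun i => subset_convexHull _ _))
      exact convexHull_mono (Set.subset_iUnion (fun i => latticePt '' (V i : Set M)) i)

/-- Two polytopes of the same dimension are strictly combinatorially isomorphic if there is an
inclusion-preserving bijection between their faces such that the affine hulls of corresponding
faces are translates of each other. -/
def StrictlyCombinatoriallyIsomorphic (P Q : LatticePolytope M) : Prop :=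
  P.dim = Q.dim ∧ ∃ φ : {G // P.IsFace G} ≃ {G // Q.IsFace G},
    (∀ G H, G.1 ⊆ H.1 → (φ G).1 ⊆ (φ H).1) ∧
    ∀ G, ∃ t : RealExt M,
      (affineSpan ℝ (φ G).1 : Set (RealExt M)) = (fun x => t + x) '' (affineSpan ℝ G.1)

/-- Two polytopes are normally equivalent if they are strictly combinatorially isomorphic and
their normal fans coincide. -/
def NormallyEquivalent (P Q : LatticePolytope M) : Prop :=
  P.StrictlyCombinatoriallyIsomorphic Q ∧ P.normalFan = Q.normalFan

end LatticePolytope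

/-- The data `R_1, …, R_k`, `π : M → Λ` of a generalized `π`-twisted Cayley sum
`R = Conv(R_1, …, R_k)`: the homomorphism `π` is surjective, the `R_i` are normally equivalent
lattice polytopes, and each `π_ℝ(R_i)` is a lattice point `v_i` of `Λ`. -/
structure IsGeneralizedTwistedCayleySum {ι : Type*} (π : M →ₗ[ℤ] Λ)
    (R : ι → LatticePolytope M) : Prop where
  surjective : Function.Surjective π
  normallyEquivalent : ∀ i j, (R i).NormallyEquivalent (R j)
  exists_image_eq : ∀ i, ∃ v : Λ, π.baseChange ℝ '' (R i).carrier = {latticePt v}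

end Cayley

section Morphisms
variable (k : Type u) [Field k] {M M' : Type u} [AddCommGroup M] [AddCommGroup M']
  [Module.Free ℤ M] [Module.Finite ℤ M] [Module.Free ℤ M'] [Module.Finite ℤ M']

/-- A morphism of toric varieties `X_P ⟶ X_Q` is toric if it is a morphism over `k` that maps the
torus of `X_P` to the torus of `X_Q` by a homomorphism of tori, that is, by the morphism
induced by a homomorphism `φ` of character lattices. -/
def IsToricMorphism {P : LatticePolytope M} {Q : LatticePolytope M'}
    (f : toricVariety k P ⟶ toricVariety k Q) : Prop :=
  f ≫ toricVarietyStr k Q = toricVarietyStr k P ∧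
  ∃ φ : dualMonoid Q.minCone →+ dualMonoid P.minCone,
    torusι k P ≫ f = monoidSpecMap k φ ≫ torusι k Q

end Morphisms

/-- For a morphism `f : X ⟶ Y` of schemes, a point `y` of `Y`, and schemes `Y` and `Z` over `B`:
the scheme-theoretic fiber of `f` at `y` is isomorphic to the base change `Z ×_B Spec κ(y)`, as a
scheme over the residue field `κ(y)`. -/
def FiberIsBaseChange {X Y Z B : Scheme.{u}} (f : X ⟶ Y) (y : Y) (b : Y ⟶ B) (z : Z ⟶ B) : Prop :=
  Nonempty (Over.mk (f.fiberToSpecResidueField y) ≅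
    Over.mk (pullback.snd z (Y.fromSpecResidueField y ≫ b)))

end ToricCayley

namespace ToricCayley

/-! ### Comparison of the normal fans of `R`, of the `R i` and of `F = π(R)` -/

section Convex

/-! The theorem is a statement about fans. A functional on `R = Conv(R_1, …, R_n)` attains its
minimum at a point of some `R_j`, so every normal cone of `R` lies in a normal cone of `R_j`; the
fan of `R_j` is that of `Y`, so the fan of `R` refines the fan of `Y`
(`IsGeneralizedTwistedCayleySum.exists_le`). Inclusions of cones therefore glue to a toric morphism
`f` (`refinementMap`).

The torus of `Y` is the chart of the smallest cone `L` of its fan. Full-dimensionality in the fibers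
makes `L` the annihilator of `ker π_ℝ`, that is, the dual space of `Λ_ℝ` embedded by `π`. The cones
of the fan of `R` inside `L` are exactly the images of the cones `τ` of the fan of `F`, and `σ ∩ L`
is such a cone for every `σ` in the fan of `R` (`pullbackCone_mem`, `inf_minCone`). Hence the
preimage of the torus under `f` is the union of the charts of these images.

A section of `π` splits the dual monoid of the image of `τ` as `(τ^∨ ∩ Λ) × ker π`, so the chart is
`U_τ × T_Y`. The splitting is compatible with inclusions of cones, and the charts glue to `X_F ×
T_Y`, with `f` the projection to `T_Y` (`exists_isPullback_refinementMap`). The fibers over all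
points of the torus are then base changes of `X_F`, and the generic point of `Y` is one of these
points. -/

theorem latticePt_injective {M : Type u} [AddCommGroup M] [Module.Free ℤ M] :
    Function.Injective (latticePt : M → RealExt M) := by
  -- A free module is flat, so tensoring `ℤ ⊆ ℝ` with `M` preserves injectivity.
  have h := Module.Flat.rTensor_preserves_injective_linearMap (M := M)
    (Algebra.linearMap ℤ ℝ) (FaithfulSMul.algebraMap_injective ℤ ℝ)
  intro a b hab
  have := @h (1 ⊗ₜ a) (1 ⊗ₜ b) (by simpa [latticePt] using hab)
  simpa using congrArg (TensorProduct.lid ℤ M) this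

variable {M Λ : Type u} [AddCommGroup M] [AddCommGroup Λ]

/-- The map `N_ℝ(Λ) → N_ℝ(M)` dual to the real extension of `π : M → Λ`. -/
noncomputable def dualExtMap (π : M →ₗ[ℤ] Λ) : DualExt Λ →ₗ[ℝ] DualExt M :=
  (π.baseChange ℝ).dualMap

@[simp] theorem dualExtMap_apply (π : M →ₗ[ℤ] Λ) (v : DualExt Λ) (x : RealExt M) :
    dualExtMap π v x = v (π.baseChange ℝ x) := rfl

@[simp] theorem baseChange_latticePt (π : M →ₗ[ℤ] Λ) (m : M) :
    π.baseChange ℝ (latticePt m) = latticePt (π m) := by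
  simp [latticePt]

theorem baseChange_surjective {π : M →ₗ[ℤ] Λ} (hπ : Function.Surjective π) :
    Function.Surjective (π.baseChange ℝ) :=
  LinearMap.lTensor_surjective ℝ hπ

theorem dualExtMap_injective {π : M →ₗ[ℤ] Λ} (hπ : Function.Surjective π) :
    Function.Injective (dualExtMap π) :=
  LinearMap.dualMap_injective_of_surjective (baseChange_surjective hπ)

/-- The image in `N_ℝ(M)` of a cone in `N_ℝ(Λ)`. -/
noncomputable abbrev pullbackCone (π : M →ₗ[ℤ] Λ) (τ : PointedCone ℝ (DualExt Λ)) :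
    PointedCone ℝ (DualExt M) :=
  PointedCone.map (dualExtMap π) τ

theorem dualExtMap_mem_pullbackCone {π : M →ₗ[ℤ] Λ} (hπ : Function.Surjective π)
    {τ : PointedCone ℝ (DualExt Λ)} {v : DualExt Λ} :
    dualExtMap π v ∈ pullbackCone π τ ↔ v ∈ τ := by
  refine ⟨?_, fun h => ⟨v, h, rfl⟩⟩
  rintro ⟨w, hw, h⟩
  exact dualExtMap_injective hπ h ▸ hw

theorem pullbackCone_mono (π : M →ₗ[ℤ] Λ) : Monotone (pullbackCone π) := by
  rintro τ τ' h _ ⟨v, hv, rfl⟩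
  exact ⟨v, h hv, rfl⟩

theorem le_of_pullbackCone_le {π : M →ₗ[ℤ] Λ} (hπ : Function.Surjective π)
    {τ τ' : PointedCone ℝ (DualExt Λ)} (h : pullbackCone π τ ≤ pullbackCone π τ') : τ ≤ τ' :=
  fun _ hv => (dualExtMap_mem_pullbackCone hπ).1 (h ((dualExtMap_mem_pullbackCone hπ).2 hv))

/-- Pulling a functional back along `π` and evaluating at `m` is evaluating it at `π m`. In
particular this dual monoid contains `ker π`, which becomes the torus factor of the chart. -/
theorem mem_dualMonoid_pullbackCone (π : M →ₗ[ℤ] Λ) (τ : PointedCone ℝ (DualExt Λ)) (m : M) :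
    m ∈ dualMonoid (pullbackCone π τ) ↔ π m ∈ dualMonoid τ := by
  constructor
  · intro h v hv
    have := h (dualExtMap π v) ⟨v, hv, rfl⟩
    simpa using this
  · rintro h _ ⟨v, hv, rfl⟩
    simpa using h v hv

namespace LatticePolytope

theorem carrier_subset_conv {ι : Type*} [Finite ι] [Nonempty ι] (R : ι → LatticePolytope M)
    (i : ι) : (R i).carrier ⊆ (conv R).carrier :=
  (Set.subset_iUnion (fun i => (R i).carrier) i).trans (subset_convexHull ℝ _)

/-- A functional attains its minimum over `Conv(R_1, …, R_k)` at a point of some `R_j`. -/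
theorem exists_mem_face_conv {ι : Type*} [Finite ι] [Nonempty ι] (R : ι → LatticePolytope M)
    (u : DualExt M) : ∃ j, ∃ x ∈ (R j).carrier, x ∈ (conv R).face u := by
  obtain ⟨V, hV⟩ := (conv R).exists_vertices
  have hV : (conv R).IsGenerating V := hV
  obtain ⟨v, -, hv⟩ := hV.exists_mem_face u
  by_contra! hcon
  -- If no point of any `R j` were minimal, all of them would lie in an open half-space that misses
  -- the minimum; so would their convex hull.
  have h : (conv R).carrier ⊆ {x | u (latticePt v) < u x} := by
    refine convexHull_min (Set.iUnion_subset fun j x hx => ?_)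
      (convex_halfSpace_gt u.isLinear _)
    by_contra hle
    exact hcon j x hx ⟨carrier_subset_conv R j hx, fun q hq => (not_lt.1 hle).trans (hv.2 q hq)⟩
  exact lt_irrefl (u (latticePt v)) (h hv.1)

end LatticePolytope

open LatticePolytope

variable {π : M →ₗ[ℤ] Λ} {ι : Type*} {R : ι → LatticePolytope M}

/-- Every cone of the normal fan of a Cayley sum of the `R_i` lies in a cone of the common normal
fan of the `R_i`. -/
theorem IsGeneralizedTwistedCayleySum.exists_le [Finite ι] [Nonempty ι]
    (hR : IsGeneralizedTwistedCayleySum π R) (i : ι) {σ : PointedCone ℝ (DualExt M)}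
    (hσ : σ ∈ (conv R).normalFan) : ∃ τ ∈ (R i).normalFan, σ ≤ τ := by
  obtain ⟨G, ⟨-, a, rfl⟩, rfl⟩ := hσ
  obtain ⟨j, x, hxj, hx⟩ := exists_mem_face_conv R a
  -- The index `j` of the minimizing polytope depends on the cone; normal equivalence allows passing
  -- from `R i` to `R j`.
  rw [(hR.normallyEquivalent i j).2]
  refine ⟨_, (R j).exists_face_normalCone_eq {x} (by simpa) (by simp), ?_⟩
  rintro u hu _ rfl p hp
  exact hu _ hx _ (carrier_subset_conv R j hp)

variable [Module.Free ℤ M] [Module.Finite ℤ M] [Module.Free ℤ Λ]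

/-- Rank–nullity over `ℤ` and over `ℝ`. It turns the dimension hypothesis into one about `ker π_ℝ`.
-/
theorem finrank_ker_baseChange (hπ : Function.Surjective π) :
    Module.finrank ℝ (LinearMap.ker (π.baseChange ℝ)) = Module.finrank ℤ (LinearMap.ker π) := by
  have h1 := (LinearMap.ker π).finrank_quotient_add_finrank
  have h2 := LinearMap.finrank_range_add_finrank_ker (π.baseChange ℝ)
  rw [(π.quotKerEquivOfSurjective hπ).finrank_eq] at h1
  rw [LinearMap.range_eq_top.2 (baseChange_surjective hπ), finrank_top,
    Module.finrank_baseChange, Module.finrank_baseChange] at h2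
  omega

/-- If the `R_i` are full-dimensional in the fibers of `π`, the smallest cone of their normal fan is
the space of the functionals that factor through `π_ℝ`. -/
theorem IsGeneralizedTwistedCayleySum.mem_minCone (hR : IsGeneralizedTwistedCayleySum π R)
    (hdim : ∀ i, (R i).dim = Module.finrank ℤ (LinearMap.ker π)) (i : ι) {u : DualExt M} :
    u ∈ (R i).minCone ↔ ∃ v, dualExtMap π v = u := by
  obtain ⟨w, hw⟩ := hR.exists_image_eq i
  have hconst : ∀ x ∈ (R i).carrier, π.baseChange ℝ x = latticePt w := fun x hx =>
    Set.mem_singleton_iff.1 (hw ▸ Set.mem_image_of_mem _ hx)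
  constructor
  · intro hu
    have hspan : ∀ f : RealExt M →ₗ[ℝ] RealExt Λ,
        (∀ x ∈ (R i).carrier, ∀ y ∈ (R i).carrier, f x = f y) →
        vectorSpan ℝ (R i).carrier ≤ LinearMap.ker f := by
      intro f hf
      refine Submodule.span_le.2 ?_
      rintro _ ⟨x, hx, y, hy, rfl⟩
      simp [hf x hx y hy]
    -- Since `π_ℝ` is constant on `R i`, the directions of `R i` lie in `ker π_ℝ`; the dimension
    -- hypothesis forces equality. A functional constant on `R i` thus kills `ker π_ℝ`, hence
    -- factors through `π_ℝ`.
    have h1 : vectorSpan ℝ (R i).carrier = LinearMap.ker (π.baseChange ℝ) :=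
      Submodule.eq_of_le_of_finrank_eq
        (hspan _ fun x hx y hy => (hconst x hx).trans (hconst y hy).symm)
        ((hdim i).trans (finrank_ker_baseChange hR.surjective).symm)
    have h2 : vectorSpan ℝ (R i).carrier ≤ LinearMap.ker u := by
      refine Submodule.span_le.2 ?_
      rintro _ ⟨x, hx, y, hy, rfl⟩
      simp [le_antisymm (hu x hx y hy) (hu y hy x hx)]
    have h3 : u ∈ LinearMap.range (π.baseChange ℝ).dualMap := by
      rw [LinearMap.range_dualMap_eq_dualAnnihilator_ker, Submodule.mem_dualAnnihilator, ← h1]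
      exact fun x hx => h2 hx
    exact h3
  · rintro ⟨v, rfl⟩ g hg p hp
    rw [dualExtMap_apply, dualExtMap_apply, hconst g hg, hconst p hp]

theorem IsGeneralizedTwistedCayleySum.mem_dualMonoid_minCone
    (hR : IsGeneralizedTwistedCayleySum π R)
    (hdim : ∀ i, (R i).dim = Module.finrank ℤ (LinearMap.ker π)) (i : ι) {m : M} :
    m ∈ dualMonoid (R i).minCone ↔ π m = 0 := by
  constructor
  · intro hm
    apply latticePt_injective
    rw [latticePt_zero, ← Module.forall_dual_apply_eq_zero_iff ℝ]
    intro v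
    -- The smallest cone is a linear subspace, so nonnegativity on it, applied to `v` and `-v`, is
    -- vanishing.
    have h : ∀ v : DualExt Λ, 0 ≤ v (latticePt (π m)) := fun v => by
      have := hm _ ((hR.mem_minCone hdim i).2 ⟨v, rfl⟩)
      simpa using this
    have h' := h (-v)
    rw [LinearMap.neg_apply] at h'
    linarith [h v]
  · intro hm u hu
    obtain ⟨v, rfl⟩ := (hR.mem_minCone hdim i).1 hu
    simp [hm]

/-- The cones of the normal fan of `π(Conv(R_1, …, R_k))` are cones of the normal fan of
`Conv(R_1, …, R_k)`. -/
theorem IsGeneralizedTwistedCayleySum.pullbackCone_mem [Finite ι] [Nonempty ι]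
    (hR : IsGeneralizedTwistedCayleySum π R)
    (hdim : ∀ i, (R i).dim = Module.finrank ℤ (LinearMap.ker π))
    {τ : PointedCone ℝ (DualExt Λ)} (hτ : τ ∈ ((conv R).map π).normalFan) :
    pullbackCone π τ ∈ (conv R).normalFan := by
  obtain ⟨G, ⟨-, v, rfl⟩, rfl⟩ := hτ
  obtain ⟨j, x, hxj, hx⟩ := exists_mem_face_conv R (dualExtMap π v)
  refine ⟨(conv R).face (dualExtMap π v), ⟨⟨x, hx⟩, _, rfl⟩, le_antisymm ?_ ?_⟩
  · rintro _ ⟨w, hw, rfl⟩ g hg p hp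
    refine hw _ ⟨⟨g, hg.1, rfl⟩, ?_⟩ _ ⟨p, hp, rfl⟩
    rintro _ ⟨q, hq, rfl⟩
    exact hg.2 q hq
  · intro u hu
    -- As `π_ℝ` is constant on `R j`, one minimizer of `v ∘ π_ℝ` in `R j` makes all of `R j` part of
    -- the face. So `u` is constant on `R j` and factors through `π_ℝ`.
    have hj : u ∈ (R j).minCone := by
      intro g hg p hp
      obtain ⟨w, hw⟩ := hR.exists_image_eq j
      refine hu g ⟨carrier_subset_conv R j hg, fun q hq => ?_⟩ p (carrier_subset_conv R j hp)
      have h1 := hx.2 q hq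
      have h2 : π.baseChange ℝ x = latticePt w :=
        Set.mem_singleton_iff.1 (hw ▸ Set.mem_image_of_mem _ hxj)
      have h3 : π.baseChange ℝ g = latticePt w :=
        Set.mem_singleton_iff.1 (hw ▸ Set.mem_image_of_mem _ hg)
      rwa [dualExtMap_apply, h2, ← h3] at h1
    obtain ⟨w, rfl⟩ := (hR.mem_minCone hdim j).1 hj
    refine ⟨w, ?_, rfl⟩
    rintro _ ⟨⟨g, hg, rfl⟩, hmin⟩ _ ⟨p, hp, rfl⟩
    exact hu g ⟨hg, fun q hq => hmin _ ⟨q, hq, rfl⟩⟩ p hp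

/-- A cone of the normal fan of `Conv(R_1, …, R_k)` meets the smallest cone of the normal fan of the
`R_i` in a cone of the normal fan of `π(Conv(R_1, …, R_k))`. -/
theorem IsGeneralizedTwistedCayleySum.inf_minCone [Finite ι] [Nonempty ι]
    (hR : IsGeneralizedTwistedCayleySum π R)
    (hdim : ∀ i, (R i).dim = Module.finrank ℤ (LinearMap.ker π)) (i : ι)
    {σ : PointedCone ℝ (DualExt M)} (hσ : σ ∈ (conv R).normalFan) :
    ∃ τ ∈ ((conv R).map π).normalFan, σ ⊓ (R i).minCone = pullbackCone π τ := by
  obtain ⟨G, ⟨hG, a, rfl⟩, rfl⟩ := hσ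
  -- The witness is the normal cone at the image of the face. That image need not be a face, but the
  -- normal cone at any nonempty subset belongs to the normal fan.
  refine ⟨_, ((conv R).map π).exists_face_normalCone_eq (π.baseChange ℝ '' (conv R).face a)
    (Set.image_mono fun x hx => hx.1) (hG.image _), le_antisymm ?_ ?_⟩
  · rintro u ⟨hu, hu'⟩
    obtain ⟨w, rfl⟩ := (hR.mem_minCone hdim i).1 hu'
    refine ⟨w, ?_, rfl⟩
    rintro _ ⟨g, hg, rfl⟩ _ ⟨p, hp, rfl⟩
    exact hu g hg p hp
  · rintro _ ⟨w, hw, rfl⟩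
    refine ⟨fun g hg p hp => ?_, (hR.mem_minCone hdim i).2 ⟨w, rfl⟩⟩
    exact hw _ ⟨g, hg, rfl⟩ _ ⟨p, hp, rfl⟩

end Convex

/-! ### Pullback squares of glued schemes -/

section Gluing

/-- A square of schemes is a pullback square if it is so over the members of an open cover of the
target of its first projection. -/
theorem isPullback_of_openCover {W X Y B : Scheme.{u}} {p : W ⟶ X} {q : W ⟶ Y} {x : X ⟶ B}
    {y : Y ⟶ B} (w : p ≫ x = q ≫ y) (𝒰 : X.OpenCover) (V : 𝒰.I₀ → Scheme.{u})
    (v : ∀ j, V j ⟶ W) (r : ∀ j, V j ⟶ 𝒰.X j) (h₁ : ∀ j, IsPullback (r j) (v j) (𝒰.f j) p)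
    (h₂ : ∀ j, IsPullback (r j) (v j ≫ q) (𝒰.f j ≫ x) y) : IsPullback p q x y := by
  -- The comparison map from `W` to the fiber product can be tested on the preimages of the cover.
  -- By pasting, `V j` is the preimage of `𝒰.X j` both in the fiber product (`h₃`) and in `W`, so
  -- the restricted comparison map is an isomorphism (`h₄`).
  have hiso : IsIso (pullback.lift p q w) := by
    change MorphismProperty.isomorphisms Scheme.{u} (pullback.lift p q w)
    rw [IsZariskiLocalAtTarget.iff_of_openCover (P := MorphismProperty.isomorphisms Scheme.{u})
      (𝒰.pullback₁ (pullback.fst x y))]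
    intro j
    have h₃ : IsPullback (v j ≫ pullback.lift p q w) (r j) (pullback.fst x y) (𝒰.f j) := by
      refine IsPullback.of_right ?_ ?_ (IsPullback.of_hasPullback x y).flip
      · rw [Category.assoc, pullback.lift_snd]
        exact (h₂ j).flip
      · rw [Category.assoc, pullback.lift_fst, (h₁ j).w]
    have h₄ : IsPullback h₃.isoPullback.hom (v j) (pullback.fst (pullback.fst x y) (𝒰.f j))
        (pullback.lift p q w) := by
      refine IsPullback.of_right ?_ ?_ (IsPullback.of_hasPullback (pullback.fst x y) (𝒰.f j)).flip
      · rw [h₃.isoPullback_hom_snd, pullback.lift_fst]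
        exact h₁ j
      · rw [h₃.isoPullback_hom_fst]
    have h₅ := h₄.flip.isoPullback_inv_snd
    change IsIso (pullback.snd (pullback.lift p q w) (pullback.fst (pullback.fst x y) (𝒰.f j)))
    rw [← h₅]
    infer_instance
  exact IsPullback.of_iso_pullback ⟨w⟩ (asIso (pullback.lift p q w))
    (pullback.lift_fst _ _ _) (pullback.lift_snd _ _ _)

variable {J : Type u} [Category.{u} J] [Quiver.IsThin J] {F G : J ⥤ Scheme.{u}}
  [∀ {i j} (f : i ⟶ j), IsOpenImmersion (F.map f)]
  [∀ {i j} (f : i ⟶ j), IsOpenImmersion (G.map f)]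
  [(F ⋙ Scheme.forget).IsLocallyDirected] [(G ⋙ Scheme.forget).IsLocallyDirected]

/-- The content is that the preimage of the chart `G j` is no larger than `F j`. If a point of `F i`
maps into it, its image comes from some `G l` with `l` over `i` and `j`; equifiberedness lifts the
point to `F l`, hence to `F j`. -/
theorem isPullback_colimMap {α : F ⟶ G} (hα : α.Equifibered) (j : J) :
    IsPullback (α.app j) (colimit.ι F j) (colimit.ι G j) (colimMap α) := by
  refine IsOpenImmersion.isPullback _ _ _ _ (by simp) ?_
  ext x
  change colimMap α x ∈ Set.range (colimit.ι G j) ↔ x ∈ Set.range (colimit.ι F j)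
  constructor
  · rintro ⟨y, hy⟩
    obtain ⟨i, x, rfl⟩ := Scheme.IsLocallyDirected.ι_jointly_surjective F x
    rw [← Scheme.Hom.comp_apply, ι_colimMap, Scheme.Hom.comp_apply,
      Scheme.IsLocallyDirected.ι_eq_ι_iff] at hy
    obtain ⟨l, fj, fi, z, rfl, hz⟩ := hy
    obtain ⟨t, ht, -⟩ := Scheme.exists_preimage_of_isPullback (hα fi) x z hz.symm
    refine ⟨F.map fj t, ?_⟩
    rw [← ht, ← Scheme.Hom.comp_apply, ← Scheme.Hom.comp_apply, colimit.w, colimit.w]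
  · rintro ⟨y, rfl⟩
    refine ⟨α.app j y, ?_⟩
    rw [← Scheme.Hom.comp_apply, ← Scheme.Hom.comp_apply, ι_colimMap]

theorem isPullback_colimMap_of_forall {α : F ⟶ G} (hα : α.Equifibered) {B Y : Scheme.{u}}
    {x : colimit G ⟶ B} {y : Y ⟶ B} {q : colimit F ⟶ Y}
    (h : ∀ j, IsPullback (α.app j) (colimit.ι F j ≫ q) (colimit.ι G j ≫ x) y) :
    IsPullback (colimMap α) q x y := by
  refine isPullback_of_openCover (colimit.hom_ext fun j => ?_)
    (Scheme.IsLocallyDirected.openCover G) (fun j => F.obj j) (fun j => colimit.ι F j)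
    (fun j => α.app j) (fun j => isPullback_colimMap hα j) h
  simpa using (h j).w

end Gluing

/-! ### Products of spectra of monoid algebras -/

section MonoidSpec
variable (k : Type u) [Field k] {A B C : Type u} [AddCommMonoid A] [AddCommMonoid B]
  [AddCommMonoid C]

/-- The hypothesis says that `C` is the direct sum of `A` and `B`, whence `k[C] = k[A] ⊗ k[B]`. The
universal property is checked directly: a cocone descends by sending the monomial of `φ a + ψ b` to
the product of the images of the monomials of `a` and `b`. -/
theorem isPushout_addMonoidAlgebra (φ : A →+ C) (ψ : B →+ C)
    (h : Function.Bijective fun p : A × B => φ p.1 + ψ p.2) :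
    IsPushout (CommRingCat.ofHom (algebraMap k (AddMonoidAlgebra k A)))
      (CommRingCat.ofHom (algebraMap k (AddMonoidAlgebra k B)))
      (CommRingCat.ofHom (AddMonoidAlgebra.mapDomainRingHom k φ))
      (CommRingCat.ofHom (AddMonoidAlgebra.mapDomainRingHom k ψ)) := by
  let e : A × B ≃+ C := AddEquiv.ofBijective (φ.coprod ψ) h
  have he : ∀ p, e p = φ p.1 + ψ p.2 := fun _ => rfl
  have heφ : ∀ a, e.symm (φ a) = (a, 0) := fun a =>
    e.injective (by rw [e.apply_symm_apply]; simp [he])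
  have heψ : ∀ b, e.symm (ψ b) = (0, b) := fun b =>
    e.injective (by rw [e.apply_symm_apply]; simp [he])
  have hsingle : ∀ c : C, (AddMonoidAlgebra.single c 1 : AddMonoidAlgebra k C) =
      AddMonoidAlgebra.mapDomainRingHom k φ (.single (e.symm c).1 1) *
        AddMonoidAlgebra.mapDomainRingHom k ψ (.single (e.symm c).2 1) := by
    intro c
    simp only [AddMonoidAlgebra.mapDomainRingHom_apply, AddMonoidAlgebra.mapDomain_single,
      AddMonoidAlgebra.single_mul_single, mul_one]
    congr 1
    exact (e.apply_symm_apply c).symm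
  have hf1 : ∀ {D : Type u} [AddCommMonoid D] {S : Type u} [CommRing S]
      (f : AddMonoidAlgebra k D →+* S), f (.single 0 1) = 1 := fun f => map_one f
  refine ⟨⟨?_⟩, ⟨PushoutCocone.IsColimit.mk _
    (fun s => CommRingCat.ofHom (AddMonoidAlgebra.liftNCRingHom
      (s.inl.hom.comp (algebraMap k (AddMonoidAlgebra k A)))
      { toFun := fun c => s.inl.hom (.single (e.symm c.toAdd).1 1) *
          s.inr.hom (.single (e.symm c.toAdd).2 1)
        map_one' := by
          simp [hf1]
        map_mul' := fun c d => by
          simp only [toAdd_mul, map_add, Prod.fst_add, Prod.snd_add]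
          rw [← one_mul (1 : k), ← AddMonoidAlgebra.single_mul_single,
            ← AddMonoidAlgebra.single_mul_single, map_mul, map_mul, one_mul]
          ring }
      fun _ _ => Commute.all _ _)) (fun s => ?_) (fun s => ?_) (fun s m h₁ h₂ => ?_)⟩⟩
  · rw [← CommRingCat.ofHom_comp, ← CommRingCat.ofHom_comp]
    congr 1
    ext x
    simp
  · ext : 1
    apply AddMonoidAlgebra.ringHom_ext <;> intro r <;> simp [heφ, hf1]
  · ext : 1
    have hs : ∀ r, s.inl.hom (.single 0 r) = s.inr.hom (.single 0 r) := fun r => by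
      simpa using RingHom.congr_fun (congr(($(s.condition)).hom)) r
    apply AddMonoidAlgebra.ringHom_ext <;> intro r <;> simp [heψ, hf1, hs]
  · ext : 1
    have h₁' : ∀ x, m.hom (AddMonoidAlgebra.mapDomainRingHom k φ x) = s.inl.hom x := fun x => by
      rw [← h₁]; rfl
    have h₂' : ∀ x, m.hom (AddMonoidAlgebra.mapDomainRingHom k ψ x) = s.inr.hom x := fun x => by
      rw [← h₂]; rfl
    apply AddMonoidAlgebra.ringHom_ext
    · intro r
      have h₃ := h₁' (.single 0 r)
      rw [AddMonoidAlgebra.mapDomainRingHom_apply, AddMonoidAlgebra.mapDomain_single,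
        map_zero] at h₃
      simp [h₃, hf1]
    · intro c
      refine (congrArg m.hom (hsingle c)).trans ((map_mul m.hom _ _).trans ?_)
      refine (congrArg₂ (· * ·) (h₁' _) (h₂' _)).trans ?_
      simp [hf1]

/-- `Spec k[A × B]` is the product of `Spec k[A]` and `Spec k[B]` over `Spec k`. -/
theorem isPullback_monoidSpec (φ : A →+ C) (ψ : B →+ C)
    (h : Function.Bijective fun p : A × B => φ p.1 + ψ p.2) :
    IsPullback (monoidSpecMap k φ) (monoidSpecMap k ψ) (monoidSpecStr k A) (monoidSpecStr k B) :=
  isPullback_SpecMap_of_isPushout _ _ _ _ (isPushout_addMonoidAlgebra k φ ψ h)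

end MonoidSpec

/-! ### Fibers over an open subscheme -/

section Fiber

/-- If `f` is over an open subscheme `T` of the target the projection of a product `Z ×_B T`, its
fibers at the points of `T` are base changes of `Z`. -/
theorem fiberIsBaseChange_of_isPullback {X Y Z B T W : Scheme.{u}} {f : X ⟶ Y} {t : T ⟶ Y}
    [IsOpenImmersion t] {b : Y ⟶ B} {z : Z ⟶ B} {j : W ⟶ X} {p : W ⟶ Z} {q : W ⟶ T}
    (hj : IsPullback j q f t) (hp : IsPullback p q z (t ≫ b)) {y : Y} (hy : y ∈ Set.range t) :
    FiberIsBaseChange f y b z := by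
  -- The point `Spec κ(y)` factors through the open subscheme `T`. Both the fiber of `f` and the
  -- base change of `Z` are then `W ×_T Spec κ(y)`, by pasting with `hj` and with `hp`.
  have hl : Set.range (Y.fromSpecResidueField y) ⊆ Set.range t := by
    rw [Scheme.range_fromSpecResidueField]
    simpa using hy
  set l := IsOpenImmersion.lift t (Y.fromSpecResidueField y) hl
  have hlt : l ≫ t = Y.fromSpecResidueField y := IsOpenImmersion.lift_fac _ _ _
  have h₁ := (IsPullback.of_hasPullback q l).flip.paste_vert hj.flip
  have h₂ := (IsPullback.of_hasPullback q l).flip.paste_vert hp.flip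
  rw [hlt] at h₁
  rw [← Category.assoc, hlt] at h₂
  let e : pullback f (Y.fromSpecResidueField y) ≅ pullback z (Y.fromSpecResidueField y ≫ b) :=
    h₁.flip.isoPullback.symm ≪≫ h₂.flip.isoPullback
  have he : e.hom ≫ pullback.snd _ _ = pullback.snd _ _ := by simp [e]
  exact ⟨Over.isoMk e he⟩

end Fiber

/-! ### The toric morphism of a refinement of fans -/

section Refinement
variable (k : Type u) [Field k] {M : Type u} [AddCommGroup M]

theorem monoidSpecMap_inclusion_comp {S T U : AddSubmonoid M} (h : S ≤ T) (h' : T ≤ U) :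
    monoidSpecMap k (AddSubmonoid.inclusion h') ≫ monoidSpecMap k (AddSubmonoid.inclusion h) =
      monoidSpecMap k (AddSubmonoid.inclusion (h.trans h')) := by
  rw [← monoidSpecMap_comp]
  rfl

variable [Module.Free ℤ M] [Module.Finite ℤ M] {P Q : LatticePolytope M}

variable (P) in
/-- The inclusion in `X_P` of the affine chart of a cone of the normal fan of `P`. -/
noncomputable def chartι (σ : P.normalFan) : monoidSpec k (dualMonoid σ.1) ⟶ toricVariety k P :=
  colimit.ι (chartDiagram k P) σ

instance (σ : P.normalFan) : IsOpenImmersion (chartι k P σ) :=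
  inferInstanceAs (IsOpenImmersion (colimit.ι (chartDiagram k P) σ))

instance : IsOpenImmersion (torusι k P) :=
  inferInstanceAs (IsOpenImmersion (colimit.ι (chartDiagram k P) _))

theorem map_chartι {σ τ : P.normalFan} (h : σ ≤ τ) :
    monoidSpecMap k (AddSubmonoid.inclusion (dualMonoid_anti h)) ≫ chartι k P τ = chartι k P σ :=
  colimit.w (chartDiagram k P) (homOfLE h)

theorem map_chartι_apply {σ τ : P.normalFan} (h : σ ≤ τ) (x : monoidSpec k (dualMonoid σ.1)) :
    chartι k P τ (monoidSpecMap k (AddSubmonoid.inclusion (dualMonoid_anti h)) x) =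
      chartι k P σ x := by
  rw [← Scheme.Hom.comp_apply, map_chartι k h]

variable {k} in
theorem toricVariety_hom_ext {Z : Scheme.{u}} {f g : toricVariety k P ⟶ Z}
    (h : ∀ σ, chartι k P σ ≫ f = chartι k P σ ≫ g) : f = g :=
  colimit.hom_ext h

theorem exists_chartι_eq (x : toricVariety k P) : ∃ σ y, chartι k P σ y = x :=
  Scheme.IsLocallyDirected.ι_jointly_surjective (chartDiagram k P) x

theorem chartι_toricVarietyStr (σ : P.normalFan) :
    chartι k P σ ≫ toricVarietyStr k P = monoidSpecStr k (dualMonoid σ.1) :=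
  colimit.ι_desc _ _

omit [Module.Free ℤ M] [Module.Finite ℤ M] in
theorem minCone_le (σ : P.normalFan) : P.minCone ≤ σ.1 := by
  obtain ⟨_, G, ⟨-, u, rfl⟩, rfl⟩ := σ
  exact fun w hw g hg => hw g hg.1

/-- The morphism to `X_Q` from the chart of a cone `σ` that is contained in a cone `τ` of the normal
fan of `Q`. -/
noncomputable def chartToToric {σ : PointedCone ℝ (DualExt M)} (τ : Q.normalFan) (h : σ ≤ τ.1) :
    monoidSpec k (dualMonoid σ) ⟶ toricVariety k Q :=
  monoidSpecMap k (AddSubmonoid.inclusion (dualMonoid_anti h)) ≫ chartι k Q τ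

theorem chartToToric_eq_of_le {σ : PointedCone ℝ (DualExt M)} {τ τ' : Q.normalFan} (h : σ ≤ τ.1)
    (h' : τ ≤ τ') : chartToToric k τ' (h.trans h') = chartToToric k τ h := by
  rw [chartToToric, chartToToric, ← map_chartι k h', ← Category.assoc,
    monoidSpecMap_inclusion_comp]

/-- Both morphisms factor through the chart of `τ ∩ τ'`, which is again a cone of the fan. This
independence is what lets arbitrary choices of `τ` glue in `refinementMap`. -/
theorem chartToToric_eq {σ : PointedCone ℝ (DualExt M)} {τ τ' : Q.normalFan} (h : σ ≤ τ.1)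
    (h' : σ ≤ τ'.1) : chartToToric k τ h = chartToToric k τ' h' := by
  let ρ : Q.normalFan := ⟨τ.1 ⊓ τ'.1, Q.inf_mem_normalFan τ.2 τ'.2⟩
  have hρ : σ ≤ ρ.1 := le_inf h h'
  exact (chartToToric_eq_of_le k hρ (show ρ.1 ≤ τ.1 from inf_le_left)).trans
    (chartToToric_eq_of_le k hρ (show ρ.1 ≤ τ'.1 from inf_le_right)).symm

theorem map_chartToToric {σ σ' : PointedCone ℝ (DualExt M)} (h : σ ≤ σ') (τ : Q.normalFan)
    (h' : σ' ≤ τ.1) :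
    monoidSpecMap k (AddSubmonoid.inclusion (dualMonoid_anti h)) ≫ chartToToric k τ h' =
      chartToToric k τ (h.trans h') := by
  rw [chartToToric, chartToToric, ← Category.assoc, monoidSpecMap_inclusion_comp]

variable (H : ∀ σ : P.normalFan, ∃ τ : Q.normalFan, σ.1 ≤ τ.1)

/-- The toric morphism `X_P ⟶ X_Q` if every cone of the normal fan of `P` is contained in a cone of
the normal fan of `Q`. -/
noncomputable def refinementMap : toricVariety k P ⟶ toricVariety k Q :=
  colimit.desc (chartDiagram k P)
    { pt := toricVariety k Q
      ι := { app := fun σ => chartToToric k (H σ).choose (H σ).choose_spec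
             naturality := fun σ σ' f => by
               refine (map_chartToToric k (leOfHom f) _ (H σ').choose_spec).trans ?_
               exact (chartToToric_eq k _ _).trans (Category.comp_id _).symm } }

theorem chartι_refinementMap (σ : P.normalFan) (τ : Q.normalFan) (h : σ.1 ≤ τ.1) :
    chartι k P σ ≫ refinementMap k H = chartToToric k τ h :=
  (colimit.ι_desc _ _).trans (chartToToric_eq k (H σ).choose_spec h)

theorem refinementMap_str : refinementMap k H ≫ toricVarietyStr k Q = toricVarietyStr k P := by
  refine toricVariety_hom_ext fun σ => ?_
  obtain ⟨τ, h⟩ := H σ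
  rw [← Category.assoc, chartι_refinementMap k H σ τ h, chartι_toricVarietyStr, chartToToric,
    Category.assoc, chartι_toricVarietyStr, monoidSpecMap_str]

theorem isToricMorphism_refinementMap (h : P.minCone ≤ Q.minCone) :
    IsToricMorphism k (refinementMap k H) :=
  ⟨refinementMap_str k H, AddSubmonoid.inclusion (dualMonoid_anti h),
    chartι_refinementMap k H ⟨_, P.minCone_mem_normalFan⟩ ⟨_, Q.minCone_mem_normalFan⟩ h⟩

/-- A point of the chart of `σ` that is mapped to the torus of `X_Q` lies in the chart of
`σ ⊓ minCone Q`. -/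
theorem exists_of_refinementMap_mem_range {σ ρ : P.normalFan} (hρ : ρ.1 = σ.1 ⊓ Q.minCone)
    (hle : ρ ≤ σ) (x : monoidSpec k (dualMonoid σ.1))
    (hx : refinementMap k H (chartι k P σ x) ∈ Set.range (torusι k Q)) :
    x ∈ Set.range (monoidSpecMap k (AddSubmonoid.inclusion (dualMonoid_anti hle))) := by
  obtain ⟨τ, h⟩ := H σ
  let μ : Q.normalFan := ⟨_, Q.minCone_mem_normalFan⟩
  have hμ : μ ≤ τ := minCone_le τ
  -- In `U_τ` the torus is the locus where the monomial of `s` does not vanish, `s` cutting the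
  -- smallest cone out of `τ`. The same `s` cuts `σ ⊓ Q.minCone` out of `σ`, so nonvanishing at the
  -- image of `x` gives the claim.
  obtain ⟨s, hs⟩ := exists_chart_functional (homOfLE hμ)
  obtain ⟨y, hy⟩ := hx
  rw [← Scheme.Hom.comp_apply, chartι_refinementMap k H σ τ h, chartToToric,
    Scheme.Hom.comp_apply] at hy
  have hy' := (chartι k Q τ).isOpenEmbedding.injective ((map_chartι_apply k hμ y).trans hy)
  have h1 := ((chart_face k (homOfLE hμ) s hs).2 _).1 ⟨y, hy'⟩
  refine ((chart_face k (homOfLE hle) (AddSubmonoid.inclusion (dualMonoid_anti h) s)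
    fun u hu => ?_).2 x).2 ?_
  · rw [hρ, Submodule.mem_inf, and_iff_right hu]
    exact hs u (h hu)
  · intro hmem
    apply h1
    change AddMonoidAlgebra.mapDomainRingHom k _ _ ∈ PrimeSpectrum.asIdeal x
    simpa using hmem

end Refinement

/-! ### The preimage of the torus as a product -/

section Product
variable (k : Type u) [Field k] {M Λ : Type u} [AddCommGroup M] [AddCommGroup Λ]
  [Module.Free ℤ M] [Module.Finite ℤ M] [Module.Free ℤ Λ] [Module.Finite ℤ Λ]
  {π : M →ₗ[ℤ] Λ} {P Y : LatticePolytope M} {F : LatticePolytope Λ}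
  (hF : ∀ τ ∈ F.normalFan, pullbackCone π τ ∈ P.normalFan)

variable (P) in
/-- The charts of `X_P` of the cones that come from the normal fan of `F`. -/
noncomputable def pullbackDiagram : F.normalFan ⥤ Scheme.{u} :=
  Monotone.functor (f := fun τ : F.normalFan => (⟨pullbackCone π τ.1, hF τ.1 τ.2⟩ : P.normalFan))
    (fun _ _ h => pullbackCone_mono π h) ⋙ chartDiagram k P

instance {τ τ' : F.normalFan} (f : τ ⟶ τ') : IsOpenImmersion ((pullbackDiagram k P hF).map f) :=
  inferInstanceAs (IsOpenImmersion ((chartDiagram k P).map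
    (homOfLE (pullbackCone_mono π (leOfHom f)) :
      (⟨pullbackCone π τ.1, hF τ.1 τ.2⟩ : P.normalFan) ⟶ ⟨pullbackCone π τ'.1, hF τ'.1 τ'.2⟩)))

/-- The homomorphism `τ^∨ ∩ Λ → (π^* τ)^∨ ∩ M` given by a section of `π`. -/
noncomputable def sectionHom {s : Λ →ₗ[ℤ] M} (hs : π ∘ₗ s = LinearMap.id)
    (τ : PointedCone ℝ (DualExt Λ)) :
    dualMonoid τ →+ dualMonoid (pullbackCone π τ) :=
  (s.toAddMonoidHom.comp (dualMonoid τ).subtype).codRestrict _ fun a => by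
    rw [mem_dualMonoid_pullbackCone]
    have : π (s a) = a := LinearMap.congr_fun hs a
    simp [this]

/-- The projections of the charts `U_{π^* τ}` of `X_P` to the charts `U_τ` of `X_F`. -/
noncomputable def pullbackProj {s : Λ →ₗ[ℤ] M} (hs : π ∘ₗ s = LinearMap.id) :
    pullbackDiagram k P hF ⟶ chartDiagram k F where
  app τ := monoidSpecMap k (sectionHom hs τ.1)
  naturality τ τ' f := by
    refine (monoidSpecMap_comp k _ _).symm.trans (Eq.trans ?_ (monoidSpecMap_comp k _ _))
    rfl

omit [Module.Free ℤ M] [Module.Finite ℤ M] [Module.Free ℤ Λ] [Module.Finite ℤ Λ] in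
theorem pullbackCone_le_minCone (hY : ∀ u, u ∈ Y.minCone ↔ ∃ v, dualExtMap π v = u)
    (τ : PointedCone ℝ (DualExt Λ)) : pullbackCone π τ ≤ Y.minCone := by
  rintro _ ⟨v, -, rfl⟩
  exact (hY _).2 ⟨v, rfl⟩

variable (hY : ∀ u, u ∈ Y.minCone ↔ ∃ v, dualExtMap π v = u)
  (hK : ∀ m, m ∈ dualMonoid Y.minCone ↔ π m = 0)

-- The section gives the unique decomposition `m = s (π m) + (m - s (π m))`, with first part from
-- `τ^∨ ∩ Λ` and second part in `ker π`, the character lattice of the torus of `Y`.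
omit [Module.Free ℤ M] [Module.Finite ℤ M] [Module.Free ℤ Λ] [Module.Finite ℤ Λ] in
include hK in
theorem isPullback_pullbackProj_app {s : Λ →ₗ[ℤ] M} (hs : π ∘ₗ s = LinearMap.id)
    (τ : PointedCone ℝ (DualExt Λ)) :
    IsPullback (monoidSpecMap k (sectionHom hs τ))
      (monoidSpecMap k (AddSubmonoid.inclusion (dualMonoid_anti (pullbackCone_le_minCone hY τ))))
      (monoidSpecStr k (dualMonoid τ)) (monoidSpecStr k (dualMonoid Y.minCone)) := by
  have hs' : ∀ a, π (s a) = a := LinearMap.congr_fun hs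
  refine isPullback_monoidSpec k _ _ ⟨?_, fun m => ?_⟩
  · rintro ⟨a, b⟩ ⟨a', b'⟩ h
    have h1 : s a + (b : M) = s a' + (b' : M) := congrArg Subtype.val h
    have h2 : (a : Λ) = a' := by
      simpa [hs', (hK _).1 b.2, (hK _).1 b'.2] using congrArg π h1
    rw [h2] at h1
    exact Prod.ext (Subtype.ext h2) (Subtype.ext (add_left_cancel h1))
  · refine ⟨⟨⟨π m, (mem_dualMonoid_pullbackCone π τ m).1 m.2⟩, ⟨m - s (π m), (hK _).2 ?_⟩⟩, ?_⟩
    · simp [hs']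
    · exact Subtype.ext (add_sub_cancel (s (π m)) (m : M))

-- The charts for `τ ≤ τ'` are products with one and the same torus, so cancelling the product
-- square of `τ'` from that of `τ` leaves the naturality square as a pullback.
omit [Module.Free ℤ M] [Module.Finite ℤ M] [Module.Free ℤ Λ] [Module.Finite ℤ Λ] in
include hY hK in
theorem equifibered_pullbackProj {s : Λ →ₗ[ℤ] M} (hs : π ∘ₗ s = LinearMap.id) :
    (pullbackProj k (P := P) hF hs).Equifibered := by
  intro τ τ' f
  refine IsPullback.of_right ?_ ((pullbackProj k hF hs).naturality f)
    (isPullback_pullbackProj_app k hY hK hs τ'.1).flip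
  have h := (isPullback_pullbackProj_app k hY hK hs τ.1).flip
  rw [← monoidSpecMap_inclusion_comp k (dualMonoid_anti (pullbackCone_le_minCone hY τ'.1))
    (dualMonoid_anti (pullbackCone_mono π (leOfHom f))),
    ← monoidSpecMap_str k (AddSubmonoid.inclusion (dualMonoid_anti (leOfHom f)))] at h
  exact h

include hF hY hK in
/-- Over the torus of `X_Y`, the morphism `X_P ⟶ X_Y` is the projection of a product of the
torus with `X_F`. -/
theorem exists_isPullback_refinementMap (hπ : Function.Surjective π)
    (H : ∀ σ : P.normalFan, ∃ τ : Y.normalFan, σ.1 ≤ τ.1)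
    (hinf : ∀ σ ∈ P.normalFan, ∃ τ ∈ F.normalFan, σ ⊓ Y.minCone = pullbackCone π τ) :
    ∃ (W : Scheme.{u}) (j : W ⟶ toricVariety k P) (p : W ⟶ toricVariety k F)
      (q : W ⟶ monoidSpec k (dualMonoid Y.minCone)),
      IsPullback j q (refinementMap k H) (torusι k Y) ∧
      IsPullback p q (toricVarietyStr k F) (torusι k Y ≫ toricVarietyStr k Y) := by
  obtain ⟨s, hs⟩ := Module.projective_lifting_property π LinearMap.id hπ
  have hα := equifibered_pullbackProj k (P := P) hF hY hK hs
  let D := pullbackDiagram k P hF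
  -- Inherited from the charts of `X_F` along the equifibered projection; hence `colimit D` is an
  -- honest gluing.
  have : (D ⋙ Scheme.forget).IsLocallyDirected :=
    Scheme.isLocallyDirected_of_equifibered_of_injective _ hα
      fun f => (D.map f).isOpenEmbedding.injective
  let g : F.normalFan → P.normalFan := fun τ => ⟨pullbackCone π τ.1, hF τ.1 τ.2⟩
  have hg : ∀ τ, (g τ).1 ≤ Y.minCone := fun τ => pullbackCone_le_minCone hY τ.1
  let a : ∀ τ, D.obj τ ⟶ monoidSpec k (dualMonoid Y.minCone) := fun τ =>
    monoidSpecMap k (AddSubmonoid.inclusion (dualMonoid_anti (hg τ)))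
  let c : ∀ τ, D.obj τ ⟶ toricVariety k P := fun τ => chartι k P (g τ)
  let q : colimit D ⟶ monoidSpec k (dualMonoid Y.minCone) := colimit.desc D
    { pt := _
      ι := { app := a
             naturality := fun τ τ' f =>
               (monoidSpecMap_inclusion_comp k _ _).trans (Category.comp_id _).symm } }
  have hq : ∀ τ, colimit.ι D τ ≫ q = a τ := fun τ => colimit.ι_desc _ _
  let j : colimit D ⟶ toricVariety k P := colimit.desc D
    { pt := _
      ι := { app := c
             naturality := fun τ τ' f =>
               (map_chartι k (σ := g τ) (τ := g τ') (pullbackCone_mono π (leOfHom f))).trans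
                 (Category.comp_id _).symm } }
  have hj : ∀ τ, colimit.ι D τ ≫ j = c τ := fun τ => colimit.ι_desc _ _
  have hj_apply : ∀ τ z, j (colimit.ι D τ z) = c τ z := fun τ z => by
    rw [← Scheme.Hom.comp_apply, hj]
  have hc : ∀ τ, c τ ≫ refinementMap k H = a τ ≫ torusι k Y := fun τ =>
    chartι_refinementMap k H (g τ) ⟨_, Y.minCone_mem_normalFan⟩ (hg τ)
  have hinj : Function.Injective j := by
    intro x x' hxx'
    obtain ⟨τ, x, rfl⟩ := Scheme.IsLocallyDirected.ι_jointly_surjective D x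
    obtain ⟨τ', x', rfl⟩ := Scheme.IsLocallyDirected.ι_jointly_surjective D x'
    rw [hj_apply, hj_apply] at hxx'
    obtain ⟨σ, f, f', z, hz, hz'⟩ :=
      (Scheme.IsLocallyDirected.ι_eq_ι_iff (chartDiagram k P) (i := g τ) (j := g τ')).1 hxx'
    -- The cone `σ` along which the two points are identified in `X_P` lies in `Y.minCone`, so it
    -- equals its intersection with it and comes from `F`. The identification thus already holds in
    -- `colimit D`.
    obtain ⟨ρ, hρ, h⟩ := hinf σ.1 σ.2
    obtain rfl : σ = g ⟨ρ, hρ⟩ :=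
      Subtype.ext ((inf_eq_left.2 (le_trans (leOfHom f : σ.1 ≤ (g τ).1) (hg τ))).symm.trans h)
    exact (Scheme.IsLocallyDirected.ι_eq_ι_iff D).2
      ⟨⟨ρ, hρ⟩, homOfLE (le_of_pullbackCone_le hπ (leOfHom f)),
        homOfLE (le_of_pullbackCone_le hπ (leOfHom f')), z, hz, hz'⟩
  have hcopen : ∀ τ, IsOpenImmersion (c τ) := fun τ =>
    inferInstanceAs (IsOpenImmersion (chartι k P (g τ)))
  have hjopen : IsOpenImmersion j :=
    IsOpenImmersion.of_openCover_source j (Scheme.IsLocallyDirected.openCover D) hinj fun τ =>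
      (congrArg (fun t => IsOpenImmersion t) (hj τ)).mpr (hcopen τ)
  have hw : j ≫ refinementMap k H = q ≫ torusι k Y := colimit.hom_ext fun τ => by
    rw [← Category.assoc, ← Category.assoc, hj, hq, hc]
  have hlocal : ∀ τ x y, x = a τ → y = monoidSpecStr k (dualMonoid τ.1) →
      IsPullback ((pullbackProj k hF hs).app τ) x y (torusι k Y ≫ toricVarietyStr k Y) := by
    rintro τ _ _ rfl rfl
    rw [show torusι k Y ≫ toricVarietyStr k Y = monoidSpecStr k (dualMonoid Y.minCone) from
      chartι_toricVarietyStr k ⟨_, Y.minCone_mem_normalFan⟩]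
    exact isPullback_pullbackProj_app k hY hK hs τ.1
  refine ⟨colimit D, j, colimMap (pullbackProj k hF hs), q,
    (IsOpenImmersion.isPullback _ _ _ _ hw ?_).flip,
    isPullback_colimMap_of_forall hα fun τ =>
      hlocal τ _ _ (hq τ) (chartι_toricVarietyStr k τ)⟩
  ext x
  change refinementMap k H x ∈ Set.range (torusι k Y) ↔ x ∈ Set.range j
  constructor
  -- In the chart of `σ`, the points over the torus form the chart of `σ ⊓ Y.minCone`, which is a
  -- member of `D`.
  · intro hx
    obtain ⟨σ, x, rfl⟩ := exists_chartι_eq k x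
    obtain ⟨τ, hτ, h⟩ := hinf σ.1 σ.2
    have hle : g ⟨τ, hτ⟩ ≤ σ := (h.symm.le.trans inf_le_left : pullbackCone π τ ≤ σ.1)
    obtain ⟨z, rfl⟩ := exists_of_refinementMap_mem_range k H (ρ := g ⟨τ, hτ⟩) h.symm hle x hx
    exact ⟨colimit.ι D ⟨τ, hτ⟩ z, (hj_apply ⟨τ, hτ⟩ z).trans (map_chartι_apply k hle z).symm⟩
  · rintro ⟨z, rfl⟩
    rw [← Scheme.Hom.comp_apply, hw]
    exact ⟨q z, rfl⟩

end Product

/-! ### The generic point -/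

section Generic
variable (k : Type u) [Field k] {M : Type u} [AddCommGroup M] [Module.Free ℤ M]

/-- A basis of `M` embeds `S` in a group of integer vectors; the unique-sums property there passes
to `S` and excludes zero divisors. -/
theorem isDomain_addMonoidAlgebra (S : AddSubmonoid M) : IsDomain (AddMonoidAlgebra k S) := by
  let b := Module.Free.chooseBasis ℤ M
  let f : S →+ (Module.Free.ChooseBasisIndex ℤ M →₀ ℤ) :=
    b.repr.toLinearMap.toAddMonoidHom.comp S.subtype
  have : TwoUniqueSums S := TwoUniqueSums.of_injective_addHom f.toAddHom
    (b.repr.injective.comp Subtype.val_injective) inferInstance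
  infer_instance

variable [Module.Finite ℤ M] (P : LatticePolytope M)

/-- A toric variety has a generic point, which lies in its torus. -/
theorem exists_isGenericPoint_mem_range_torusι :
    ∃ η : toricVariety k P, IsGenericPoint η Set.univ ∧ η ∈ Set.range (torusι k P) := by
  have hdom : ∀ S : AddSubmonoid M, IsDomain (AddMonoidAlgebra k S) :=
    isDomain_addMonoidAlgebra k
  let pt : ∀ S : AddSubmonoid M, monoidSpec k S := fun S =>
    (⊥ : PrimeSpectrum (AddMonoidAlgebra k S))
  -- The zero ideal contracts to the zero ideal along the injection `k[S] → k[T]`, so the generic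
  -- points of all charts agree with that of the torus.
  have hpt : ∀ {S T : AddSubmonoid M} (h : S ≤ T),
      monoidSpecMap k (AddSubmonoid.inclusion h) (pt T) = pt S := fun h =>
    PrimeSpectrum.ext ((RingHom.injective_iff_ker_eq_bot _).1
      (AddMonoidAlgebra.mapDomain_injective (AddSubmonoid.inclusion_injective h)))
  refine ⟨torusι k P (pt _), ?_, _, rfl⟩
  rw [isGenericPoint_def, Set.eq_univ_iff_forall]
  intro x
  obtain ⟨σ, x, rfl⟩ := exists_chartι_eq k x
  have h := map_chartι_apply k (σ := ⟨_, P.minCone_mem_normalFan⟩) (minCone_le σ) (pt _)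
  rw [hpt] at h
  have hx : pt _ ⤳ x :=
    (PrimeSpectrum.le_iff_specializes (⊥ : PrimeSpectrum (AddMonoidAlgebra k _)) x).1 bot_le
  exact (h ▸ hx.map (chartι k P σ).continuous : torusι k P (pt _) ⤳ _).mem_closure

end Generic

end ToricCayley

theorem mainTheorem4 {k : Type u} [Field k]
    {M Λ : Type u} [AddCommGroup M] [Module.Free ℤ M] [Module.Finite ℤ M]
    [AddCommGroup Λ] [Module.Free ℤ Λ] [Module.Finite ℤ Λ]
    (π : M →ₗ[ℤ] Λ) {ι : Type} [Finite ι] [Nonempty ι] (R : ι → ToricCayley.LatticePolytope M)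
    (hR : ToricCayley.IsGeneralizedTwistedCayleySum π R)
    (hdim : ∀ i, (R i).dim = Module.finrank ℤ (LinearMap.ker π)) (i : ι) :
    ∃ f : ToricCayley.toricVariety k (ToricCayley.LatticePolytope.conv R) ⟶
        ToricCayley.toricVariety k (R i),
      ToricCayley.IsToricMorphism k f ∧
      (∃ η : ToricCayley.toricVariety k (R i), IsGenericPoint η Set.univ ∧
        ToricCayley.FiberIsBaseChange f η (ToricCayley.toricVarietyStr k (R i))
          (ToricCayley.toricVarietyStr k ((ToricCayley.LatticePolytope.conv R).map π))) ∧
      ∀ y ∈ Set.range (ToricCayley.torusι k (R i)),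
        ToricCayley.FiberIsBaseChange f y (ToricCayley.toricVarietyStr k (R i))
          (ToricCayley.toricVarietyStr k ((ToricCayley.LatticePolytope.conv R).map π)) := by
  have H : ∀ σ : (ToricCayley.LatticePolytope.conv R).normalFan,
      ∃ τ : (R i).normalFan, σ.1 ≤ τ.1 := fun σ => by
    obtain ⟨τ, hτ, h⟩ := hR.exists_le i σ.2
    exact ⟨⟨τ, hτ⟩, h⟩
  obtain ⟨W, j, p, q, hj, hp⟩ := ToricCayley.exists_isPullback_refinementMap k
    (fun τ hτ => hR.pullbackCone_mem hdim hτ) (fun u => hR.mem_minCone hdim i)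
    (fun m => hR.mem_dualMonoid_minCone hdim i) hR.surjective H
    (fun σ hσ => hR.inf_minCone hdim i hσ)
  have hfib : ∀ y ∈ Set.range (ToricCayley.torusι k (R i)),
      ToricCayley.FiberIsBaseChange (ToricCayley.refinementMap k H) y
        (ToricCayley.toricVarietyStr k (R i))
        (ToricCayley.toricVarietyStr k ((ToricCayley.LatticePolytope.conv R).map π)) :=
    fun y hy => ToricCayley.fiberIsBaseChange_of_isPullback hj hp hy
  obtain ⟨η, hη, hηT⟩ := ToricCayley.exists_isGenericPoint_mem_range_torusι k (R i)
  refine ⟨ToricCayley.refinementMap k H, ToricCayley.isToricMorphism_refinementMap k H ?_,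
    ⟨η, hη, hfib η hηT⟩, hfib⟩
  -- A functional constant on `R` is constant on `R i`, so the torus of `X_R` maps to the torus of
  -- `Y`.
  exact fun u hu g hg p hp => hu g (ToricCayley.LatticePolytope.carrier_subset_conv R i hg) p
    (ToricCayley.LatticePolytope.carrier_subset_conv R i hp)
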